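/- Work over $\mathbb{C}$ with classical (reduced) varieties. For $p\ge 1$ let $S^p$ be the space of symmetric $p$-forms on $\mathbb{C}^3$, i.e. symmetric tensors $\Omega=(\Omega_{i_1\dots i_p})_{0\le i_1,\dots,i_p\le 2}$, and for $x\in\mathbb{C}^3$ let $\Omega(x)$ be the contraction $\Omega(x)_{i_1\dots i_{p-1}}=\sum_{i}\Omega_{i\,i_1\dots i_{p-1}}x_i$. For $k\ge 1$ let $$\mathbb{P}Jet_k=\{(x,l,b_2,\dots,b_k)\ :\ l(x)=0,\ b_2(x)\sim l,\ b_3(x)\sim b_2,\ \dots,\ b_k(x)\sim b_{k-1}\}\subset \mathbb{P}^2\times\mathbb{P}(S^1)\times\mathbb{P}(S^2)\times\dots\times\mathbb{P}(S^k),$$ where $b_j(x)\sim b_{j-1}$ (with $b_1=l$) means that $b_j(x)$ is a multiple, possibly zero, of $b_{j-1}$. **Proposition.** Let $k\ge 1$. 1. $\mathbb{P}Jet_k$ is a closed subvariety of the product of projective spaces and is smooth. If $k\ge 2$, the map $\mathbb{P}Jet_k\to\mathbb{P}Jet_{k-1}$ forgetting $b_k$ is a projective bundle with fibre $\mathbb{P}^{k+1}$,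 Zariski-locally trivial with transition maps linear on the fibres. 2. For $2\le i<k$ the image $Y$ of the map $(x,l,b_2,\dots,b_k)\mapsto(x,l,b_2,\dots,b_{i-1},b_{i+1},\dots,b_k)$ is a closed subvariety, and the map $\mathbb{P}Jet_k\to Y$ is the blowup of $Y$ along the closed subvariety $\{b_{i+1}(x)=0\}\subset Y$. -/

import Mathlib

open scoped LinearAlgebra.Projectivization Topology

noncomputable section

namespace JetVar

/-! ### Classical complex varieties in products of projective spaces -/

/-- The product `∏ i, ℙ(ℂ^{n i})` of complex projective spaces, where the (finite) type `n i`
indexes the homogeneous coordinates of the `i`-th factor. It carries the Zariski topology. -/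
def MultiProj {ι : Type} (n : ι → Type) : Type := ∀ i, ℙ ℂ (n i → ℂ)

section Basic

variable {ι κ : Type} {n : ι → Type} {m : κ → Type}

/-- `F` is multihomogeneous of multidegree `d` (of degree `d i` in the coordinates of the `i`-th
factor). -/
def IsMultihom (F : MvPolynomial (Σ i, n i) ℂ) (d : ι →₀ ℕ) : Prop :=
  MvPolynomial.IsWeightedHomogeneous (fun s : Σ i, n i => Finsupp.single s.1 1) F d

/-- The value of a polynomial in the homogeneous coordinates at the chosen representative of `P`.
For multihomogeneous polynomials, vanishing at `P`, and the value at `P` of a quotient of two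
polynomials of the same multidegree, do not depend on the representative. -/
def evalAt (F : MvPolynomial (Σ i, n i) ℂ) (P : MultiProj n) : ℂ :=
  MvPolynomial.eval (fun s => (P s.1).rep s.2) F

/-- The Zariski topology: the nonvanishing loci of multihomogeneous polynomials form a basis. -/
instance : TopologicalSpace (MultiProj n) :=
  TopologicalSpace.generateFrom
    {O | ∃ (F : MvPolynomial (Σ i, n i) ℂ) (d : ι →₀ ℕ), IsMultihom F d ∧
      O = {P | evalAt F P ≠ 0}}

/-- The function `g` on `X` is regular at `P`: on a neighbourhood of `P` in `X` it is a quotient of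
two multihomogeneous polynomials of the same multidegree, with nonvanishing denominator.
Only the values of `g` on `X` matter. -/
def RegularWithinAt (g : MultiProj n → ℂ) (X : Set (MultiProj n)) (P : MultiProj n) : Prop :=
  ∃ (d : ι →₀ ℕ) (F H : MvPolynomial (Σ i, n i) ℂ), IsMultihom F d ∧ IsMultihom H d ∧
    ∀ᶠ Q in 𝓝[X] P, evalAt H Q ≠ 0 ∧ g Q = evalAt F Q / evalAt H Q

/-- `φ` restricts to a morphism of varieties `X → Y`: it is continuous and pulls regular functions
back to regular functions. Only the values of `φ` on `X` matter. -/
def IsMorphismOn (φ : MultiProj n → MultiProj m) (X : Set (MultiProj n))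
    (Y : Set (MultiProj m)) : Prop :=
  Set.MapsTo φ X Y ∧ ContinuousOn φ X ∧
    ∀ P ∈ X, ∀ g : MultiProj m → ℂ, RegularWithinAt g Y (φ P) → RegularWithinAt (g ∘ φ) X P

/-- `φ` restricts to an isomorphism of varieties `X → Y` with inverse `ψ`. -/
def IsIsoOn (φ : MultiProj n → MultiProj m) (ψ : MultiProj m → MultiProj n)
    (X : Set (MultiProj n)) (Y : Set (MultiProj m)) : Prop :=
  IsMorphismOn φ X Y ∧ IsMorphismOn ψ Y X ∧ Set.InvOn ψ φ X Y

/-- `X` is smooth (Jacobian criterion): near each of its points `P`, the set `X` is the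
zero locus of finitely many multihomogeneous polynomials whose differentials at `P` are linearly
independent. By Euler's relation these differentials kill the radial directions, so that their rank
may be computed in homogeneous coordinates. -/
def IsSmoothVariety (X : Set (MultiProj n)) : Prop :=
  ∀ P ∈ X, ∃ (c : ℕ) (F : Fin c → MvPolynomial (Σ i, n i) ℂ),
    (∀ j, ∃ d, IsMultihom (F j) d) ∧
    (∀ᶠ Q in 𝓝 P, Q ∈ X ↔ ∀ j, evalAt (F j) Q = 0) ∧
    LinearIndependent ℂ
      (fun (j : Fin c) (s : Σ i, n i) => evalAt (MvPolynomial.pderiv s (F j)) P)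

/-! ### The product with `ℙ^r` -/

/-- The coordinates of `(∏ i, ℙ(ℂ^{n i})) × ℙ^r`. -/
abbrev withProj (n : ι → Type) (r : ℕ) : ι ⊕ Unit → Type :=
  Sum.elim n (fun _ => Fin (r + 1))

/-- The point `(u, v)` of the product with `ℙ^r`. -/
def pair {r : ℕ} (u : MultiProj n) (v : ℙ ℂ (Fin (r + 1) → ℂ)) : MultiProj (withProj n r) :=
  fun s => match s with
    | Sum.inl i => u i
    | Sum.inr _ => v

/-- The projection of the product with `ℙ^r` to the first factor. -/
def fstPt {r : ℕ} (Q : MultiProj (withProj n r)) : MultiProj n := fun i => Q (Sum.inl i)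

/-- The projection of the product with `ℙ^r` to `ℙ^r`. -/
def sndPt {r : ℕ} (Q : MultiProj (withProj n r)) : ℙ ℂ (Fin (r + 1) → ℂ) := Q (Sum.inr ())

/-! ### Projective bundles and blowups -/

/-- `π : X → B` is a projective bundle of rank `r`, i.e. with fibre `ℙ^r`: there are isomorphisms
`Φ a : π⁻¹(B ∩ O a) → (B ∩ O a) × ℙ^r` over `B ∩ O a`, for a Zariski open cover `O` of `B`, whose
transition maps are linear on the fibres. -/
def IsProjectiveBundle (π : MultiProj n → MultiProj m) (X : Set (MultiProj n))
    (B : Set (MultiProj m)) (r : ℕ) : Prop :=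
  IsMorphismOn π X B ∧
  ∃ (A : Type) (O : A → Set (MultiProj m)) (Φ : A → MultiProj n → MultiProj (withProj m r))
    (Ψ : A → MultiProj (withProj m r) → MultiProj n),
    (∀ a, IsOpen (O a)) ∧ B ⊆ ⋃ a, O a ∧
    (∀ a, IsIsoOn (Φ a) (Ψ a) (X ∩ π ⁻¹' O a) {Q | fstPt Q ∈ B ∩ O a}) ∧
    (∀ a, ∀ P ∈ X ∩ π ⁻¹' O a, fstPt (Φ a P) = π P) ∧
    (∀ a b, ∀ u ∈ B ∩ O a ∩ O b, ∃ g : (Fin (r + 1) → ℂ) ≃ₗ[ℂ] (Fin (r + 1) → ℂ),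
      ∀ v : ℙ ℂ (Fin (r + 1) → ℂ),
        sndPt (Φ b (Ψ a (pair u v))) = Projectivization.map g.toLinearMap g.injective v)

/-- On `Y ∩ O` (with `O` open), the functions `f 0, …, f r` are regular and generate the
ideal sheaf of the functions that vanish on `Z`. -/
def GeneratesIdealOn {r : ℕ} (f : Fin (r + 1) → MultiProj m → ℂ) (Z Y O : Set (MultiProj m)) :
    Prop :=
  (∀ j, ∀ u ∈ Y ∩ O, RegularWithinAt (f j) Y u) ∧
  (∀ j, ∀ u ∈ Z ∩ O, f j u = 0) ∧
  ∀ u ∈ Y ∩ O, ∀ g : MultiProj m → ℂ, RegularWithinAt g Y u → (∀ᶠ Q in 𝓝[Z] u, g Q = 0) →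
    ∃ h : Fin (r + 1) → MultiProj m → ℂ, (∀ j, RegularWithinAt (h j) Y u) ∧
      ∀ᶠ Q in 𝓝[Y] u, g Q = ∑ j, h j Q * f j Q

/-- The graph in `(Y ∩ O) × ℙ^r` of the map `u ↦ [f 0 u : … : f r u]`, defined where the `f j`
have no common zero. -/
def ratGraph {r : ℕ} (f : Fin (r + 1) → MultiProj m → ℂ) (Y O : Set (MultiProj m)) :
    Set (MultiProj (withProj m r)) :=
  {Q | ∃ u ∈ Y ∩ O, ∃ hu : (fun j => f j u) ≠ 0, Q = pair u (Projectivization.mk ℂ _ hu)}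

/-- `π : X → Y` is the blowup of the variety `Y` along its closed subvariety `Z`: for a cover of `Y`
by open sets `Y ∩ O` on which the ideal sheaf of `Z` has generators `f 0, …, f r`, the restriction
of `π` over `Y ∩ O` is isomorphic, over `Y ∩ O`, to the closure in `(Y ∩ O) × ℙ^r` of the graph of
`[f 0 : … : f r] : (Y ∩ O) ∖ Z → ℙ^r`. -/
def IsBlowup (π : MultiProj n → MultiProj m) (X : Set (MultiProj n)) (Y Z : Set (MultiProj m)) :
    Prop :=
  IsMorphismOn π X Y ∧ (∃ C, IsClosed C ∧ Z = Y ∩ C) ∧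
  ∀ y ∈ Y, ∃ O : Set (MultiProj m), IsOpen O ∧ y ∈ O ∧
    ∃ (r : ℕ) (f : Fin (r + 1) → MultiProj m → ℂ), GeneratesIdealOn f Z Y O ∧
      ∃ (Φ : MultiProj n → MultiProj (withProj m r)) (Ψ : MultiProj (withProj m r) → MultiProj n),
        IsIsoOn Φ Ψ (X ∩ π ⁻¹' O) (closure (ratGraph f Y O) ∩ {Q | fstPt Q ∈ Y ∩ O}) ∧
        ∀ P ∈ X ∩ π ⁻¹' O, fstPt (Φ P) = π P

end Basic

/-! ### Projectivized jets -/

/-- Symmetric `p`-forms on `ℂ³`: the component `Ω_{i₁,…,i_p}` of the symmetric tensor `Ω` depends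
only on the multiset `{i₁,…,i_p}` of indices. -/
abbrev SymForm (p : ℕ) : Type := Sym (Fin 3) p → ℂ

/-- The contraction `Ω(x)`, a symmetric `p`-form:
`Ω(x)_{i₁,…,i_p} = ∑ i, Ω_{i,i₁,…,i_p} x_i`. -/
def contract {p : ℕ} (x : Fin 3 → ℂ) (Ω : SymForm (p + 1)) : SymForm p :=
  fun s => ∑ i, Ω (i ::ₛ s) * x i

/-- The coordinates of `ℙ²_x × ∏_{j ∈ S} ℙ(symmetric j-forms)`. -/
abbrev jetCoord (S : Finset ℕ) : Unit ⊕ S → Type :=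
  Sum.elim (fun _ => Fin 3) (fun j => Sym (Fin 3) (j : ℕ))

/-- `ℙ²_x × ∏_{j ∈ S} ℙ(symmetric j-forms)`, with points `(x, (b_j)_{j ∈ S})`; the line `l` is the
`1`-form `b_1`. -/
abbrev JetAmbient (S : Finset ℕ) : Type := MultiProj (jetCoord S)

/-- A representative of the point `x ∈ ℙ²`. -/
def JetAmbient.x {S : Finset ℕ} (P : JetAmbient S) : Fin 3 → ℂ :=
  Projectivization.rep (K := ℂ) (V := Fin 3 → ℂ) (P (Sum.inl ()))

/-- A representative of the form `b_j`. -/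
def JetAmbient.b {S : Finset ℕ} (P : JetAmbient S) (j : ℕ) (hj : j ∈ S) : SymForm j :=
  Projectivization.rep (K := ℂ) (V := SymForm j) (P (Sum.inr ⟨j, hj⟩))

/-- The space of projectivized jets `(x, l = b_1, b_2, …, b_k)`: `l(x) = 0` and `b_{j+1}(x) ∼ b_j`
for `1 ≤ j < k`, where `b_{j+1}(x) ∼ b_j` means that `b_{j+1}(x)` is a (possibly zero) multiple
of `b_j`. -/
def PJet (k : ℕ) : Set (JetAmbient (Finset.Icc 1 k)) :=
  {P | (∀ h : 1 ∈ Finset.Icc 1 k, contract (p := 0) P.x (P.b 1 h) = 0) ∧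
    ∀ (j : ℕ) (h : j ∈ Finset.Icc 1 k) (h' : j + 1 ∈ Finset.Icc 1 k),
      ∃ c : ℂ, contract P.x (P.b (j + 1) h') = c • P.b j h}

/-- The map that keeps `x` and the `b_j` with `j ∈ T` and forgets the others. -/
def forget {S T : Finset ℕ} (hTS : T ⊆ S) (P : JetAmbient S) : JetAmbient T :=
  fun s => match s with
    | Sum.inl u => P (Sum.inl u)
    | Sum.inr j => P (Sum.inr ⟨j.1, hTS j.2⟩)

/-- The locus `b_j(x) = 0`, for `j = i + 1`. -/
def vanishLocus {S : Finset ℕ} (i : ℕ) (h : i + 1 ∈ S) : Set (JetAmbient S) :=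
  {P | contract P.x (P.b (i + 1) h) = 0}

end JetVar

end

/-! Everything is local on charts, where `x` and the forms are normalised by `x α = 1` and `b j (s
j) = 1`. The basic fact is linear: if `x α = 1`, the equation `Ω(x) = β` can be solved for the
components of `Ω` whose index contains `α`, while the other components stay free (`recon`,
`eq_recon`). So the forms `Ω` of degree `p + 1` with `Ω(x) ∼ β` make up a vector space, with linear
coordinates given by the factor of proportionality and the `p + 2` components that avoid `α`
(`fibreCoord`, `fibreForm`). This yields the bundle with fibre `ℙ^(p+2)`: two charts give two linear
coordinate systems on the same space. Since contraction with `x` is surjective, the local equations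
are also independent: their Jacobian is block triangular in the forms (`linearIndependent_jetEqn`).

For the second part let `i = p + 1`. The image `Y` is cut out by the relations between the remaining
forms and by `b_{p+2}(x)(x) ∼ b_p`. That last condition puts `b_{p+2}(x)` in the vector space above,
and its linear coordinates there are the functions `blowGen`. The missing form is a nonzero `v` in
the same space with `b_{p+2}(x) ∼ v`, so locally the jets are the pairs `(y, [v])` with `blowGen y`
a multiple of `v` (`isIsoOn_blowModel`).

This incidence set is the blowup because `b_{p+2}(x)` can be moved freely: for every `d` in the
fibre space, correcting the higher forms one after the other changes `b_{p+2}(x)` by `d` without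
leaving the equations of `Y` (`imageCond_deformed`). The choice `d = -b_{p+2}(x)` gives a local
retraction onto the centre, whence `blowGen` generates its ideal (`generatesIdealOn_blowGen`). The
choice `d = t • v`, `t → 0`, shows that every `[v]` over the centre is a limit of points of the
graph (`blowModel_subset`). -/

noncomputable section

namespace JetVar

/-! ### Homogeneous coordinates -/

section Lifts

variable {n : Type}

/-- `v` is a vector of homogeneous coordinates of `p`. -/
def Lifts (v : n → ℂ) (p : ℙ ℂ (n → ℂ)) : Prop := ∃ c : ℂ, c ≠ 0 ∧ v = c • p.rep

theorem lifts_rep (p : ℙ ℂ (n → ℂ)) : Lifts p.rep p := ⟨1, one_ne_zero, (one_smul _ _).symm⟩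

theorem Lifts.ne_zero {v : n → ℂ} {p : ℙ ℂ (n → ℂ)} (h : Lifts v p) : v ≠ 0 := by
  obtain ⟨c, hc, rfl⟩ := h
  exact smul_ne_zero hc p.rep_nonzero

theorem Lifts.mk_eq {v : n → ℂ} {p : ℙ ℂ (n → ℂ)} (h : Lifts v p) :
    Projectivization.mk ℂ v h.ne_zero = p := by
  obtain ⟨c, hc, hv⟩ := id h
  conv_rhs => rw [← p.mk_rep]
  exact (Projectivization.mk_eq_mk_iff' ℂ _ _ _ _).2 ⟨c, hv.symm⟩

theorem Lifts.unique {v : n → ℂ} {p q : ℙ ℂ (n → ℂ)} (h : Lifts v p) (h' : Lifts v q) : p = q := by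
  rw [← h.mk_eq, ← h'.mk_eq]

theorem lifts_mk (v : n → ℂ) (hv : v ≠ 0) : Lifts v (Projectivization.mk ℂ v hv) := by
  obtain ⟨a, ha⟩ := Projectivization.exists_smul_eq_mk_rep ℂ v hv
  refine ⟨(a : ℂ)⁻¹, inv_ne_zero a.ne_zero, ?_⟩
  rw [← ha, Units.smul_def, smul_smul, inv_mul_cancel₀ a.ne_zero, one_smul]

theorem Lifts.smul {v : n → ℂ} {p : ℙ ℂ (n → ℂ)} (h : Lifts v p) {c : ℂ} (hc : c ≠ 0) :
    Lifts (c • v) p := by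
  obtain ⟨a, ha, rfl⟩ := h
  exact ⟨c * a, mul_ne_zero hc ha, smul_smul _ _ _⟩

theorem Lifts.exists_smul {v w : n → ℂ} {p : ℙ ℂ (n → ℂ)} (h : Lifts v p) (h' : Lifts w p) :
    ∃ c : ℂ, c ≠ 0 ∧ v = c • w := by
  obtain ⟨a, ha, rfl⟩ := h
  obtain ⟨b, hb, rfl⟩ := h'
  exact ⟨a * b⁻¹, mul_ne_zero ha (inv_ne_zero hb), by
    rw [smul_smul, mul_assoc, inv_mul_cancel₀ hb, mul_one]⟩

/-- The point with homogeneous coordinates `v`; an arbitrary point if `v = 0`. -/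
def toProj [Nonempty n] (v : n → ℂ) : ℙ ℂ (n → ℂ) :=
  open Classical in
  if h : v ≠ 0 then Projectivization.mk ℂ v h
  else Projectivization.mk ℂ (fun _ => 1) (Function.ne_iff.2 ⟨Classical.arbitrary n, one_ne_zero⟩)

theorem lifts_toProj [Nonempty n] {v : n → ℂ} (h : v ≠ 0) : Lifts v (toProj v) := by
  rw [toProj, dif_pos h]
  exact lifts_mk v h

end Lifts

section General

variable {ι κ : Type} {n : ι → Type} {m : κ → Type}

theorem eval_scale {F : MvPolynomial (Σ i, n i) ℂ} {d : ι →₀ ℕ} (hF : IsMultihom F d)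
    (c : ι → ℂ) (y : (Σ i, n i) → ℂ) :
    MvPolynomial.eval (fun s => c s.1 * y s) F =
      (d.prod fun i e => c i ^ e) * MvPolynomial.eval y F := by
  rw [MvPolynomial.eval_eq, MvPolynomial.eval_eq, Finset.mul_sum]
  refine Finset.sum_congr rfl fun e he => ?_
  have hw := hF (MvPolynomial.mem_support_iff.1 he)
  have : ∏ s ∈ e.support, c s.1 ^ e s = d.prod fun i e => c i ^ e := by
    rw [← hw, Finsupp.weight_apply, Finsupp.prod_sum_index (by simp) (by simp [pow_add])]
    refine Finset.prod_congr rfl fun s _ => ?_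
    simp
  simp_rw [mul_pow, Finset.prod_mul_distrib]
  rw [this]
  ring

/-- The scalar depends on the multidegree only, not on the polynomial, so it cancels in quotients of
equal multidegree. -/
theorem eval_lift {P : MultiProj n}
    {v : ∀ i, n i → ℂ} (hv : ∀ i, Lifts (v i) (P i)) :
    ∃ c : (ι →₀ ℕ) → ℂ, (∀ d, c d ≠ 0) ∧ ∀ (F : MvPolynomial (Σ i, n i) ℂ) (d : ι →₀ ℕ),
      IsMultihom F d → MvPolynomial.eval (fun s => v s.1 s.2) F = c d * evalAt F P := by
  choose a ha hva using hv
  refine ⟨fun d => d.prod fun i e => a i ^ e, fun d => ?_, fun F d hF => ?_⟩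
  · exact Finset.prod_ne_zero_iff.2 fun i _ => pow_ne_zero _ (ha i)
  · rw [evalAt, ← eval_scale hF]
    simp [hva]

theorem isOpen_evalAt {F : MvPolynomial (Σ i, n i) ℂ} {d : ι →₀ ℕ} (hF : IsMultihom F d) :
    IsOpen {P | evalAt F P ≠ 0} :=
  TopologicalSpace.isOpen_generateFrom_of_mem ⟨F, d, hF, rfl⟩

theorem evalAt_mul (F G : MvPolynomial (Σ i, n i) ℂ) (P : MultiProj n) :
    evalAt (F * G) P = evalAt F P * evalAt G P := map_mul _ _ _

theorem evalAt_add (F G : MvPolynomial (Σ i, n i) ℂ) (P : MultiProj n) :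
    evalAt (F + G) P = evalAt F P + evalAt G P := map_add _ _ _

theorem isMultihom_X (s : Σ i, n i) :
    IsMultihom (MvPolynomial.X s : MvPolynomial (Σ i, n i) ℂ) (Finsupp.single s.1 1) :=
  MvPolynomial.isWeightedHomogeneous_X _ _ _

theorem isMultihom_C (c : ℂ) : IsMultihom (MvPolynomial.C c : MvPolynomial (Σ i, n i) ℂ) 0 :=
  MvPolynomial.isWeightedHomogeneous_C _ _

/-! ### Regular functions -/

section Regular

variable {X : Set (MultiProj n)} {P : MultiProj n} {g g' : MultiProj n → ℂ}

theorem RegularWithinAt.congr (h : RegularWithinAt g X P) (hg : ∀ᶠ Q in 𝓝[X] P, g' Q = g Q) :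
    RegularWithinAt g' X P := by
  obtain ⟨d, F, H, hF, hH, e⟩ := h
  refine ⟨d, F, H, hF, hH, ?_⟩
  filter_upwards [e, hg] with Q h1 h2
  exact ⟨h1.1, h2.trans h1.2⟩

theorem regularWithinAt_const (c : ℂ) : RegularWithinAt (fun _ => c) X P :=
  ⟨0, MvPolynomial.C c, MvPolynomial.C 1, isMultihom_C _, isMultihom_C _, by simp [evalAt]⟩

theorem RegularWithinAt.add (h : RegularWithinAt g X P) (h' : RegularWithinAt g' X P) :
    RegularWithinAt (fun Q => g Q + g' Q) X P := by
  obtain ⟨d, F, H, hF, hH, e⟩ := h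
  obtain ⟨d', F', H', hF', hH', e'⟩ := h'
  refine ⟨d + d', F * H' + H * F', H * H', (hF.mul hH').add (hH.mul hF'), hH.mul hH', ?_⟩
  filter_upwards [e, e'] with Q h1 h2
  refine ⟨by rw [evalAt_mul]; exact mul_ne_zero h1.1 h2.1, ?_⟩
  rw [h1.2, h2.2, div_add_div _ _ h1.1 h2.1, evalAt_add, evalAt_mul, evalAt_mul, evalAt_mul]

theorem RegularWithinAt.mul (h : RegularWithinAt g X P) (h' : RegularWithinAt g' X P) :
    RegularWithinAt (fun Q => g Q * g' Q) X P := by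
  obtain ⟨d, F, H, hF, hH, e⟩ := h
  obtain ⟨d', F', H', hF', hH', e'⟩ := h'
  refine ⟨d + d', F * F', H * H', hF.mul hF', hH.mul hH', ?_⟩
  filter_upwards [e, e'] with Q h1 h2
  refine ⟨by rw [evalAt_mul]; exact mul_ne_zero h1.1 h2.1, ?_⟩
  rw [h1.2, h2.2, evalAt_mul, evalAt_mul, div_mul_div_comm]

theorem RegularWithinAt.neg (h : RegularWithinAt g X P) :
    RegularWithinAt (fun Q => -g Q) X P := by
  simpa using (regularWithinAt_const (-1)).mul h

theorem RegularWithinAt.sub (h : RegularWithinAt g X P) (h' : RegularWithinAt g' X P) :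
    RegularWithinAt (fun Q => g Q - g' Q) X P := by
  simpa [sub_eq_add_neg] using h.add h'.neg

theorem RegularWithinAt.sum {A : Type*} (S : Finset A) {G : A → MultiProj n → ℂ}
    (h : ∀ a ∈ S, RegularWithinAt (G a) X P) : RegularWithinAt (fun Q => ∑ a ∈ S, G a Q) X P := by
  classical
  induction S using Finset.induction_on with
  | empty => simpa using regularWithinAt_const 0
  | insert a S ha ih =>
    simp_rw [Finset.sum_insert ha]
    exact (h a (by simp)).add (ih fun b hb => h b (by simp [hb]))

theorem RegularWithinAt.eval {σ : Type*} {r : σ → MultiProj n → ℂ}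
    (hr : ∀ s, RegularWithinAt (r s) X P) (F : MvPolynomial σ ℂ) :
    RegularWithinAt (fun Q => MvPolynomial.eval (fun s => r s Q) F) X P := by
  induction F using MvPolynomial.induction_on with
  | C a => simpa using regularWithinAt_const a
  | add p q hp hq => simpa using hp.add hq
  | mul_X p s hp => simpa using hp.mul (hr s)

theorem RegularWithinAt.eventually_ne (h : RegularWithinAt g X P) (hP : P ∈ X) (hg : g P ≠ 0) :
    ∀ᶠ Q in 𝓝[X] P, g Q ≠ 0 := by
  obtain ⟨d, F, H, hF, hH, e⟩ := h
  have h0 := e.self_of_nhdsWithin hP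
  have hFP : evalAt F P ≠ 0 := fun h => hg (by rw [h0.2, h, zero_div])
  filter_upwards [e, mem_nhdsWithin_of_mem_nhds ((isOpen_evalAt hF).mem_nhds hFP)] with Q h1 h2
  rw [h1.2]
  exact div_ne_zero h2 h1.1

theorem RegularWithinAt.inv (h : RegularWithinAt g X P) (hP : P ∈ X) (hg : g P ≠ 0) :
    RegularWithinAt (fun Q => (g Q)⁻¹) X P := by
  have hne := h.eventually_ne hP hg
  obtain ⟨d, F, H, hF, hH, e⟩ := h
  refine ⟨d, H, F, hH, hF, ?_⟩
  filter_upwards [e, hne] with Q h1 h2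
  rw [h1.2] at h2 ⊢
  exact ⟨fun h => h2 (by rw [h, zero_div]), inv_div _ _⟩

theorem eventually_rep_ne {i : ι} {c : n i} (hc : (P i).rep c ≠ 0) :
    ∀ᶠ Q in 𝓝[X] P, (Q i).rep c ≠ 0 := by
  have : IsOpen {Q : MultiProj n | (Q i).rep c ≠ 0} := by
    simpa [evalAt] using isOpen_evalAt (isMultihom_X (⟨i, c⟩ : Σ i, n i))
  exact mem_nhdsWithin_of_mem_nhds (this.mem_nhds hc)

theorem regularWithinAt_ratio {i : ι} (t : n i) {c : n i} (hc : (P i).rep c ≠ 0) :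
    RegularWithinAt (fun Q => (Q i).rep t / (Q i).rep c) X P := by
  refine ⟨_, _, _, isMultihom_X (⟨i, t⟩ : Σ i, n i), isMultihom_X (⟨i, c⟩ : Σ i, n i), ?_⟩
  filter_upwards [eventually_rep_ne hc] with Q hQ
  simpa [evalAt] using hQ

/-- A set that is locally the zero locus of regular functions is closed. -/
theorem isClosed_of_regular {C : Set (MultiProj n)}
    (h : ∀ P, ∃ (O : Set (MultiProj n)) (A : Type) (G : A → MultiProj n → ℂ), IsOpen O ∧ P ∈ O ∧
      (∀ a, RegularWithinAt (G a) Set.univ P) ∧ ∀ Q ∈ O, Q ∈ C ↔ ∀ a, G a Q = 0) :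
    IsClosed C := by
  rw [← isOpen_compl_iff, isOpen_iff_mem_nhds]
  intro P hP
  obtain ⟨O, A, G, hO, hPO, hG, hC⟩ := h P
  rw [Set.mem_compl_iff, hC P hPO] at hP
  push Not at hP
  obtain ⟨a, ha⟩ := hP
  have := (hG a).eventually_ne (Set.mem_univ P) ha
  rw [nhdsWithin_univ] at this
  filter_upwards [this, hO.mem_nhds hPO] with Q h1 h2 h3
  exact h1 ((hC Q h2).1 h3 a)

end Regular

/-! ### Maps given by regular homogeneous coordinates -/

/-- Near `P`, the map `φ` is given on `X` by homogeneous coordinates that are regular functions. -/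
def LocRepAt (φ : MultiProj n → MultiProj m) (X : Set (MultiProj n)) (P : MultiProj n) : Prop :=
  ∃ r : ∀ i, m i → MultiProj n → ℂ, (∀ i t, RegularWithinAt (r i t) X P) ∧
    ∀ᶠ Q in 𝓝[X] P, ∀ i, Lifts (fun t => r i t Q) (φ Q i)

section LocRep

variable {φ : MultiProj n → MultiProj m} {X : Set (MultiProj n)} {Y : Set (MultiProj m)}
  {P : MultiProj n}

/-- Substituting regular coordinates into `F` gives a regular function, and the nonvanishing locus
of a regular function is open. -/
theorem LocRepAt.tendsto (h : LocRepAt φ X P) (hP : P ∈ X) :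
    Filter.Tendsto φ (𝓝[X] P) (𝓝 (φ P)) := by
  obtain ⟨r, hr, e⟩ := h
  rw [TopologicalSpace.tendsto_nhds_generateFrom_iff]
  rintro _ ⟨F, d, hF, rfl⟩ hPF
  have hreg := RegularWithinAt.eval (r := fun s : Σ i, m i => r s.1 s.2) (fun s => hr s.1 s.2) F
  obtain ⟨c, hc, hcF⟩ := eval_lift (e.self_of_nhdsWithin hP)
  have hne := hreg.eventually_ne hP (by
    rw [hcF F d hF]
    exact mul_ne_zero (hc d) hPF)
  filter_upwards [hne, e] with Q h1 h2
  obtain ⟨c, hc, hcF⟩ := eval_lift h2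
  rw [hcF F d hF] at h1
  exact right_ne_zero_of_mul h1

theorem LocRepAt.regular_comp (h : LocRepAt φ X P) (hP : P ∈ X) (hXY : Set.MapsTo φ X Y)
    {g : MultiProj m → ℂ} (hg : RegularWithinAt g Y (φ P)) : RegularWithinAt (g ∘ φ) X P := by
  have ht : Filter.Tendsto φ (𝓝[X] P) (𝓝[Y] (φ P)) :=
    tendsto_nhdsWithin_iff.2 ⟨h.tendsto hP, eventually_mem_nhdsWithin.mono hXY⟩
  obtain ⟨r, hr, e⟩ := h
  obtain ⟨d, F, H, hF, hH, e'⟩ := hg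
  have hreg := RegularWithinAt.eval (r := fun s : Σ i, m i => r s.1 s.2) (fun s => hr s.1 s.2)
  have key : ∀ᶠ Q in 𝓝[X] P, MvPolynomial.eval (fun s : Σ i, m i => r s.1 s.2 Q) H ≠ 0 ∧
      g (φ Q) = MvPolynomial.eval (fun s : Σ i, m i => r s.1 s.2 Q) F *
        (MvPolynomial.eval (fun s : Σ i, m i => r s.1 s.2 Q) H)⁻¹ := by
    filter_upwards [e, ht.eventually e'] with Q h1 h2
    obtain ⟨c, hc, hcF⟩ := eval_lift h1
    rw [hcF F d hF, hcF H d hH, h2.2]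
    refine ⟨mul_ne_zero (hc d) h2.1, ?_⟩
    rw [← div_eq_mul_inv, mul_div_mul_left _ _ (hc d)]
  exact ((hreg F).mul ((hreg H).inv hP (key.self_of_nhdsWithin hP).1)).congr
    (key.mono fun Q h => h.2)

theorem isMorphismOn_of_locRep (hXY : Set.MapsTo φ X Y) (h : ∀ P ∈ X, LocRepAt φ X P) :
    IsMorphismOn φ X Y :=
  ⟨hXY, fun P hP => (h P hP).tendsto hP, fun P hP _ hg => (h P hP).regular_comp hP hXY hg⟩

end LocRep

/-! ### The ideal generated by a family of functions -/

/-- The functions that, on `X` near `P`, are combinations of the `f j` with regular coefficients. -/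
def idealAt {r : ℕ} (f : Fin (r + 1) → MultiProj n → ℂ) (X : Set (MultiProj n))
    (P : MultiProj n) : AddSubgroup (MultiProj n → ℂ) where
  carrier := {g | ∃ h : Fin (r + 1) → MultiProj n → ℂ, (∀ j, RegularWithinAt (h j) X P) ∧
    ∀ᶠ Q in 𝓝[X] P, g Q = ∑ j, h j Q * f j Q}
  zero_mem' := ⟨fun _ _ => 0, fun _ => regularWithinAt_const 0, by simp⟩
  add_mem' := by
    rintro a b ⟨h, hr, e⟩ ⟨h', hr', e'⟩
    refine ⟨fun j Q => h j Q + h' j Q, fun j => (hr j).add (hr' j), ?_⟩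
    filter_upwards [e, e'] with Q h1 h2
    simp [h1, h2, add_mul, Finset.sum_add_distrib]
  neg_mem' := by
    rintro a ⟨h, hr, e⟩
    refine ⟨fun j Q => -h j Q, fun j => (hr j).neg, ?_⟩
    filter_upwards [e] with Q h1
    simp [h1]

section Ideal

variable {r : ℕ} {f : Fin (r + 1) → MultiProj n → ℂ} {X : Set (MultiProj n)} {P : MultiProj n}
  {g g' : MultiProj n → ℂ}

theorem idealAt_mul (hg : RegularWithinAt g X P) (hg' : g' ∈ idealAt f X P) :
    (fun Q => g Q * g' Q) ∈ idealAt f X P := by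
  obtain ⟨h, hr, e⟩ := hg'
  refine ⟨fun j Q => g Q * h j Q, fun j => hg.mul (hr j), ?_⟩
  filter_upwards [e] with Q h1
  simp [h1, Finset.mul_sum, mul_assoc]

theorem idealAt_congr (hg : g ∈ idealAt f X P) (h : ∀ᶠ Q in 𝓝[X] P, g' Q = g Q) :
    g' ∈ idealAt f X P := by
  obtain ⟨a, hr, e⟩ := hg
  exact ⟨a, hr, by filter_upwards [e, h] with Q h1 h2; rw [h2, h1]⟩

theorem mem_idealAt_self (j : Fin (r + 1)) : f j ∈ idealAt f X P :=
  ⟨fun i _ => if i = j then 1 else 0, fun i => regularWithinAt_const _, by simp⟩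

/-- Away from the common zeros the ideal is the unit ideal: `g = (g / f j) * f j`. -/
theorem mem_idealAt_of_ne (hg : RegularWithinAt g X P) (hP : P ∈ X) {j : Fin (r + 1)}
    (hf : RegularWithinAt (f j) X P) (hj : f j P ≠ 0) : g ∈ idealAt f X P := by
  refine idealAt_congr (idealAt_mul (hg.mul (hf.inv hP hj)) (mem_idealAt_self j)) ?_
  filter_upwards [hf.eventually_ne hP hj] with Q hQ
  field_simp

/-- Polynomials respect congruences modulo the ideal; the product step is `p(u) u_s - p(v) v_s = u_s
(p(u) - p(v)) + p(v) (u_s - v_s)`. -/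
theorem eval_sub_eval_mem_idealAt {σ : Type*} {u v : σ → MultiProj n → ℂ}
    (hu : ∀ s, RegularWithinAt (u s) X P) (hv : ∀ s, RegularWithinAt (v s) X P)
    (h : ∀ s, (fun Q => u s Q - v s Q) ∈ idealAt f X P) (F : MvPolynomial σ ℂ) :
    (fun Q => MvPolynomial.eval (fun s => u s Q) F - MvPolynomial.eval (fun s => v s Q) F) ∈
      idealAt f X P := by
  induction F using MvPolynomial.induction_on with
  | C a =>
    simp only [MvPolynomial.eval_C, sub_self]
    exact (idealAt f X P).zero_mem
  | add p q hp hq =>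
    convert add_mem hp hq using 1
    ext Q
    simp
    ring
  | mul_X p s hp =>
    convert add_mem (idealAt_mul (hu s) hp) (idealAt_mul (RegularWithinAt.eval hv p) (h s)) using 1
    ext Q
    simp
    ring

end Ideal

end General

/-! ### Reconstruction of a symmetric form from its contraction -/

section Contract

variable {p : ℕ}

theorem contract_add (x : Fin 3 → ℂ) (Ω Ω' : SymForm (p + 1)) :
    contract x (Ω + Ω') = contract x Ω + contract x Ω' := by
  ext s
  simp [contract, add_mul, Finset.sum_add_distrib]

theorem contract_smul (x : Fin 3 → ℂ) (c : ℂ) (Ω : SymForm (p + 1)) :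
    contract x (c • Ω) = c • contract x Ω := by
  ext s
  simp [contract, Finset.mul_sum, mul_assoc]

theorem contract_smul_left (x : Fin 3 → ℂ) (c : ℂ) (Ω : SymForm (p + 1)) :
    contract (c • x) Ω = c • contract x Ω := by
  ext s
  simp only [contract, Pi.smul_apply, smul_eq_mul, Finset.mul_sum]
  exact Finset.sum_congr rfl fun i _ => by ring

/-- `Ω(x)` is a multiple of `β`. -/
def Rel (x : Fin 3 → ℂ) (Ω : SymForm (p + 1)) (β : SymForm p) : Prop :=
  ∃ c : ℂ, contract x Ω = c • β

theorem rel_smul_iff {x : Fin 3 → ℂ} {Ω : SymForm (p + 1)} {β : SymForm p} {a b c : ℂ}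
    (ha : a ≠ 0) (hb : b ≠ 0) (hc : c ≠ 0) : Rel (a • x) (b • Ω) (c • β) ↔ Rel x Ω β := by
  simp only [Rel, contract_smul, contract_smul_left, smul_smul]
  constructor
  · rintro ⟨e, he⟩
    refine ⟨(b * a)⁻¹ * (e * c), ?_⟩
    rw [← smul_smul, ← he, smul_smul, inv_mul_cancel₀ (mul_ne_zero hb ha), one_smul]
  · rintro ⟨e, he⟩
    refine ⟨b * a * e * c⁻¹, ?_⟩
    rw [he, smul_smul, inv_mul_cancel_right₀ hc, mul_assoc]

/-- Normalising `β s = 1` makes the unknown factor a component of `γ`, so that it varies regularly.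
-/
theorem eq_coord_smul {β γ : SymForm p} {s : Sym (Fin 3) p} (hs : β s = 1)
    (h : ∃ c : ℂ, γ = c • β) : γ = γ s • β := by
  obtain ⟨c, rfl⟩ := h
  simp [hs]

theorem rel_iff_coord {x : Fin 3 → ℂ} {Ω : SymForm (p + 1)} {β : SymForm p} {s : Sym (Fin 3) p}
    (hs : β s = 1) : Rel x Ω β ↔ ∀ t, contract x Ω t - contract x Ω s * β t = 0 := by
  constructor
  · intro h t
    conv_lhs => enter [1]; rw [eq_coord_smul hs h]
    simp
  · intro h
    exact ⟨contract x Ω s, funext fun t => sub_eq_zero.1 (h t)⟩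

/-- The form `Ω` whose components off the index `α` are those of `w` and with `Ω(x) = β`,
if `x α = 1`. -/
def recon (x : Fin 3 → ℂ) (α : Fin 3) (β : SymForm p) (w : SymForm (p + 1)) : SymForm (p + 1) :=
  fun t => if h : α ∈ t then
      -- The component of `Ω(x) = β` at `t.erase α`, solved for `Ω t` with coefficient `x α = 1`.
      -- The other terms contain `α` one time fewer, so the recursion stops.
      β (t.erase α h) - ∑ j : {j // j ≠ α}, x j * recon x α β w (j.1 ::ₛ t.erase α h)
    else w t
termination_by t => (t : Multiset (Fin 3)).count α
decreasing_by
  have := Multiset.count_pos.2 (Sym.mem_coe.2 h)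
  rw [Sym.coe_cons, Sym.coe_erase, Multiset.count_cons_of_ne j.2.symm, Multiset.count_erase_self]
  omega

theorem recon_of_notMem {x : Fin 3 → ℂ} {α : Fin 3} {β : SymForm p} {w : SymForm (p + 1)}
    {t : Sym (Fin 3) (p + 1)} (h : α ∉ t) : recon x α β w t = w t := by
  rw [recon, dif_neg h]

theorem recon_cons (x : Fin 3 → ℂ) (α : Fin 3) (β : SymForm p) (w : SymForm (p + 1))
    (s : Sym (Fin 3) p) :
    recon x α β w (α ::ₛ s) = β s - ∑ j : {j // j ≠ α}, x j * recon x α β w (j.1 ::ₛ s) := by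
  rw [recon, dif_pos (Sym.mem_cons_self α s)]
  simp only [Sym.erase_cons_head]

theorem contract_eq (x : Fin 3 → ℂ) (α : Fin 3) (Ω : SymForm (p + 1)) (s : Sym (Fin 3) p) :
    contract x Ω s = Ω (α ::ₛ s) * x α + ∑ j : {j // j ≠ α}, x j * Ω (j.1 ::ₛ s) := by
  rw [contract, Fintype.sum_eq_add_sum_subtype_ne _ α]
  simp_rw [mul_comm]

theorem contract_recon {x : Fin 3 → ℂ} {α : Fin 3} (hx : x α = 1) (β : SymForm p)
    (w : SymForm (p + 1)) : contract x (recon x α β w) = β := by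
  ext s
  rw [contract_eq x α, recon_cons, hx]
  ring

theorem sym_count_induction (α : Fin 3) {C : Sym (Fin 3) (p + 1) → Prop}
    (off : ∀ t, α ∉ t → C t)
    (step : ∀ s : Sym (Fin 3) p, (∀ j, j ≠ α → C (j ::ₛ s)) → C (α ::ₛ s)) (t) : C t := by
  induction h : (t : Multiset (Fin 3)).count α using Nat.strong_induction_on generalizing t with
  | _ N ih =>
    by_cases ht : α ∈ t
    · obtain ⟨s, rfl⟩ : ∃ s, t = α ::ₛ s := ⟨_, (Sym.cons_erase ht).symm⟩
      refine step s fun j hj => ih _ ?_ _ rfl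
      rw [← h, Sym.coe_cons, Sym.coe_cons, Multiset.count_cons_of_ne hj.symm,
        Multiset.count_cons_self]
      exact Nat.lt_succ_self _
    · exact off t ht

/-- Both sides satisfy the same recursion on the multiplicity of `α`. This uniqueness also yields
the linearity of `recon` in `(β, w)`. -/
theorem eq_recon {x : Fin 3 → ℂ} {α : Fin 3} (hx : x α = 1) {β : SymForm p}
    {w Ω : SymForm (p + 1)} (hβ : contract x Ω = β) (hw : ∀ t, α ∉ t → Ω t = w t) :
    Ω = recon x α β w := by
  subst hβ
  ext t
  induction t using sym_count_induction α with
  | off t ht => rw [recon_of_notMem ht, hw t ht]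
  | step s ih =>
    rw [recon_cons, contract_eq x α, hx,
      Finset.sum_congr rfl fun j _ => congrArg (x j.1 * ·) (ih j.1 j.2)]
    ring

theorem recon_add {x : Fin 3 → ℂ} {α : Fin 3} (hx : x α = 1) (β β' : SymForm p)
    (w w' : SymForm (p + 1)) :
    recon x α (β + β') (w + w') = recon x α β w + recon x α β' w' := by
  refine (eq_recon hx ?_ fun t ht => ?_).symm
  · rw [contract_add, contract_recon hx, contract_recon hx]
  · simp [recon_of_notMem ht]

theorem recon_smul {x : Fin 3 → ℂ} {α : Fin 3} (hx : x α = 1) (c : ℂ) (β : SymForm p)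
    (w : SymForm (p + 1)) : recon x α (c • β) (c • w) = c • recon x α β w := by
  refine (eq_recon hx ?_ fun t ht => ?_).symm
  · rw [contract_smul, contract_recon hx]
  · simp [recon_of_notMem ht]

/-- The recursion is linear in `(β, w)` with coefficients polynomial in `x`. Stated for a general
`M`, it serves both the regular functions and the ideal of the centre. -/
theorem recon_mem {T : Type*} (M : AddSubgroup (T → ℂ)) {x : T → Fin 3 → ℂ} {α : Fin 3}
    {β : T → SymForm p} {w : T → SymForm (p + 1)}
    (hx : ∀ j, ∀ g ∈ M, (fun Q => x Q j * g Q) ∈ M) (hβ : ∀ s, (fun Q => β Q s) ∈ M)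
    (hw : ∀ t, α ∉ t → (fun Q => w Q t) ∈ M) (t : Sym (Fin 3) (p + 1)) :
    (fun Q => recon (x Q) α (β Q) (w Q) t) ∈ M := by
  induction t using sym_count_induction α with
  | off t ht => simpa only [recon_of_notMem ht] using hw t ht
  | step s ih =>
    simp_rw [recon_cons]
    have := sum_mem (t := Finset.univ) fun (j : {j // j ≠ α}) _ => hx j.1 _ (ih j.1 j.2)
    convert sub_mem (hβ s) this using 1
    ext Q
    simp

end Contract

/-! ### Linear coordinates on the fibres -/

section Fibre

/-- These are the multisets of size `p` in the two remaining indices. -/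
theorem card_avoiding (α : Fin 3) (p : ℕ) :
    Fintype.card {t : Sym (Fin 3) p // α ∉ t} = p + 1 := by
  have e : Sym {j : Fin 3 // j ≠ α} p ≃ {t : Sym (Fin 3) p // α ∉ t} := by
    refine Equiv.ofBijective (fun s => ⟨s.map Subtype.val, ?_⟩) ⟨fun s s' h => ?_, ?_⟩
    · simp [Sym.mem_map]
    · exact Sym.map_injective Subtype.val_injective _ (Subtype.ext_iff.1 h)
    · rintro ⟨t, ht⟩
      refine ⟨t.attach.map fun j => ⟨j.1, fun h => ht (h ▸ j.2)⟩, Subtype.ext ?_⟩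
      simp only [Sym.map_map]
      exact Sym.attach_map_coe t
  rw [← Fintype.card_congr e, Sym.card_sym_eq_multichoose, ← Nat.multichoose_two]
  simp [Fintype.card_subtype_compl]

/-- Indices of the linear coordinates on the fibres. -/
def fibreIndex (α : Fin 3) (p : ℕ) :
    Fin (p + 1 + 1 + 1) ≃ Option {t : Sym (Fin 3) (p + 1) // α ∉ t} :=
  -- The `p + 2` indices avoiding `α` carry the free components; `none` carries the factor of
  -- proportionality.
  (Fintype.equivFinOfCardEq (by rw [Fintype.card_option, card_avoiding])).symm

variable {p : ℕ}

/-- Linear coordinates on the space of the forms `Ω` such that `Ω(x)` is a multiple of a form `β`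
with `β s = 1`. -/
def fibreCoord (x : Fin 3 → ℂ) (α : Fin 3) (s : Sym (Fin 3) p) :
    SymForm (p + 1) →ₗ[ℂ] (Fin (p + 1 + 1 + 1) → ℂ) where
  toFun Ω a := (fibreIndex α p a).elim (contract x Ω s) fun t => Ω t.1
  map_add' Ω Ω' := by
    ext a
    cases h : fibreIndex α p a <;> simp [h, contract_add]
  map_smul' c Ω := by
    ext a
    cases h : fibreIndex α p a <;> simp [h, contract_smul]

/-- The form with given linear coordinates. -/
def fibreForm (x : Fin 3 → ℂ) (α : Fin 3) (β : SymForm p) (v : Fin (p + 1 + 1 + 1) → ℂ) :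
    SymForm (p + 1) :=
  recon x α (v ((fibreIndex α p).symm none) • β)
    fun t => if h : α ∉ t then v ((fibreIndex α p).symm (some ⟨t, h⟩)) else 0

variable {x : Fin 3 → ℂ} {α : Fin 3} {β : SymForm p} {s : Sym (Fin 3) p}

theorem contract_fibreForm (hx : x α = 1) (v : Fin (p + 1 + 1 + 1) → ℂ) :
    contract x (fibreForm x α β v) = v ((fibreIndex α p).symm none) • β :=
  contract_recon hx _ _

theorem rel_fibreForm (hx : x α = 1) (v : Fin (p + 1 + 1 + 1) → ℂ) :
    Rel x (fibreForm x α β v) β :=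
  ⟨_, contract_fibreForm hx v⟩

theorem fibreCoord_fibreForm (hx : x α = 1) (hs : β s = 1) (v : Fin (p + 1 + 1 + 1) → ℂ) :
    fibreCoord x α s (fibreForm x α β v) = v := by
  ext a
  obtain ⟨o, rfl⟩ := (fibreIndex α p).symm.surjective a
  cases o with
  | none => simp [fibreCoord, contract_fibreForm hx, hs]
  | some t => simp [fibreCoord, fibreForm, recon_of_notMem t.2, t.2]

theorem fibreForm_fibreCoord (hx : x α = 1) (hs : β s = 1) {Ω : SymForm (p + 1)}
    (hΩ : Rel x Ω β) : fibreForm x α β (fibreCoord x α s Ω) = Ω := by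
  refine (eq_recon hx ?_ fun t ht => ?_).symm
  · simpa [fibreCoord] using eq_coord_smul hs hΩ
  · simp [fibreCoord, ht]

theorem fibreForm_add (hx : x α = 1) (v w : Fin (p + 1 + 1 + 1) → ℂ) :
    fibreForm x α β (v + w) = fibreForm x α β v + fibreForm x α β w := by
  rw [fibreForm, fibreForm, fibreForm, ← recon_add hx]
  congr 1
  · simp [add_smul]
  · ext t
    by_cases h : α ∈ t <;> simp [h]

theorem fibreForm_smul (hx : x α = 1) (c : ℂ) (v : Fin (p + 1 + 1 + 1) → ℂ) :
    fibreForm x α β (c • v) = c • fibreForm x α β v := by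
  rw [fibreForm, fibreForm, ← recon_smul hx]
  congr 1
  · simp [smul_smul]
  · ext t
    by_cases h : α ∈ t <;> simp [h]

theorem fibreForm_ne_zero (hx : x α = 1) (hs : β s = 1) {v : Fin (p + 1 + 1 + 1) → ℂ}
    (hv : v ≠ 0) : fibreForm x α β v ≠ 0 := by
  intro h
  apply hv
  rw [← fibreCoord_fibreForm hx hs v, h, map_zero]

theorem fibreCoord_ne_zero (hx : x α = 1) (hs : β s = 1) {Ω : SymForm (p + 1)}
    (hΩ : Rel x Ω β) (h0 : Ω ≠ 0) : fibreCoord x α s Ω ≠ 0 := by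
  intro h
  apply h0
  rw [← fibreForm_fibreCoord hx hs hΩ, h]
  simpa using fibreForm_smul (β := β) hx 0 0

theorem fibreForm_mem {T : Type*} (M : AddSubgroup (T → ℂ)) {x : T → Fin 3 → ℂ} {α : Fin 3}
    {β : T → SymForm p} {v : T → Fin (p + 1 + 1 + 1) → ℂ}
    (hx : ∀ j, ∀ g ∈ M, (fun Q => x Q j * g Q) ∈ M)
    (hβ : ∀ s, ∀ g ∈ M, (fun Q => β Q s * g Q) ∈ M)
    (hv : ∀ a, (fun Q => v Q a) ∈ M) (t : Sym (Fin 3) (p + 1)) :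
    (fun Q => fibreForm (x Q) α (β Q) (v Q) t) ∈ M := by
  refine recon_mem M hx (fun s => ?_) (fun t ht => ?_) t
  · simpa [mul_comm] using hβ s _ (hv _)
  · simpa [ht] using hv _

end Fibre

/-! ### Coordinates of jets -/

section Jet

variable {S T : Finset ℕ}

/-- A representative of the form `b_j`, and zero for `j ∉ S`. -/
def JetAmbient.form (P : JetAmbient S) (j : ℕ) : SymForm j :=
  if h : j ∈ S then P.b j h else 0

theorem form_eq (P : JetAmbient S) {j : ℕ} (h : j ∈ S) : P.form j = P.b j h := dif_pos h

/-- `x` and the `b j` with `j ∈ S` are homogeneous coordinates of `P`. -/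
def IsLift (x : Fin 3 → ℂ) (b : ∀ j, SymForm j) (P : JetAmbient S) : Prop :=
  Lifts (n := Fin 3) x (P (Sum.inl ())) ∧
    ∀ (j : ℕ) (h : j ∈ S), Lifts (n := Sym (Fin 3) j) (b j) (P (Sum.inr ⟨j, h⟩))

theorem isLift_rep (P : JetAmbient S) : IsLift P.x P.form P :=
  ⟨lifts_rep _, fun _ h => by rw [form_eq P h]; exact lifts_rep _⟩

/-- The point with homogeneous coordinates `x` and `b j`. -/
def mkJet (S : Finset ℕ) (x : Fin 3 → ℂ) (b : ∀ j, SymForm j) : JetAmbient S := fun s =>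
  match s with
  | Sum.inl _ => toProj (n := Fin 3) x
  | Sum.inr j => toProj (n := Sym (Fin 3) j) (b j)

theorem isLift_mkJet {x : Fin 3 → ℂ} {b : ∀ j, SymForm j} (hx : x ≠ 0) (hb : ∀ j ∈ S, b j ≠ 0) :
    IsLift x b (mkJet S x b) :=
  ⟨lifts_toProj hx, fun j h => lifts_toProj (hb j h)⟩

section

variable {x x' : Fin 3 → ℂ} {b b' : ∀ j, SymForm j} {P Q : JetAmbient S}

theorem IsLift.unique (h : IsLift x b P) (h' : IsLift x b Q) : P = Q := by
  funext s
  rcases s with ⟨⟩ | ⟨j, hj⟩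
  · exact Lifts.unique h.1 h'.1
  · exact Lifts.unique (h.2 j hj) (h'.2 j hj)

theorem IsLift.congr (h : IsLift x b P) (hb : ∀ j ∈ S, b' j = b j) : IsLift x b' P :=
  ⟨h.1, fun j hj => by rw [hb j hj]; exact h.2 j hj⟩

theorem IsLift.x_ne_zero (h : IsLift x b P) : x ≠ 0 := Lifts.ne_zero h.1

theorem IsLift.b_ne_zero (h : IsLift x b P) {j : ℕ} (hj : j ∈ S) : b j ≠ 0 :=
  Lifts.ne_zero (h.2 j hj)

theorem IsLift.forget (h : IsLift x b P) (hTS : T ⊆ S) : IsLift x b (forget hTS P) :=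
  ⟨h.1, fun j hj => h.2 j (hTS hj)⟩

/-- The defining conditions are invariant under rescaling each factor, so the chosen representatives
may be exchanged for affine coordinates. -/
theorem IsLift.contract_eq_zero_iff (h : IsLift x b P) (h' : IsLift x' b' P) {j : ℕ}
    (hj : j + 1 ∈ S) : contract x (b (j + 1)) = 0 ↔ contract x' (b' (j + 1)) = 0 := by
  obtain ⟨c, hc, rfl⟩ := h.1.exists_smul h'.1
  obtain ⟨d, hd, hb⟩ := (h.2 _ hj).exists_smul (h'.2 _ hj)
  rw [hb, contract_smul, contract_smul_left, smul_eq_zero_iff_right hd,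
    smul_eq_zero_iff_right hc]

theorem IsLift.rel_iff (h : IsLift x b P) (h' : IsLift x' b' P) {j : ℕ} (hj : j ∈ S)
    (hj' : j + 1 ∈ S) : Rel x (b (j + 1)) (b j) ↔ Rel x' (b' (j + 1)) (b' j) := by
  obtain ⟨c, hc, rfl⟩ := h.1.exists_smul h'.1
  obtain ⟨d, hd, hb⟩ := (h.2 _ hj).exists_smul (h'.2 _ hj)
  obtain ⟨e, he, hb'⟩ := (h.2 _ hj').exists_smul (h'.2 _ hj')
  rw [hb, hb']
  exact rel_smul_iff hc he hd

theorem IsLift.rel_contract_iff (h : IsLift x b P) (h' : IsLift x' b' P) {j : ℕ} (hj : j ∈ S)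
    (hj' : j + 1 + 1 ∈ S) :
    Rel x (contract x (b (j + 1 + 1))) (b j) ↔ Rel x' (contract x' (b' (j + 1 + 1))) (b' j) := by
  obtain ⟨c, hc, rfl⟩ := h.1.exists_smul h'.1
  obtain ⟨d, hd, hb⟩ := (h.2 _ hj).exists_smul (h'.2 _ hj)
  obtain ⟨e, he, hb'⟩ := (h.2 _ hj').exists_smul (h'.2 _ hj')
  rw [hb, hb', contract_smul, contract_smul_left, smul_smul]
  exact rel_smul_iff hc (mul_ne_zero he hc) hd

theorem mem_PJet_iff {k : ℕ} {P : JetAmbient (Finset.Icc 1 k)} (h : IsLift x b P) :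
    P ∈ PJet k ↔ (1 ≤ k → contract x (b 1) = 0) ∧
      ∀ j, 1 ≤ j → j + 1 ≤ k → Rel x (b (j + 1)) (b j) := by
  refine and_congr ⟨fun H hk => ?_, fun H hk => ?_⟩ ⟨fun H j h1 h2 => ?_, fun H j h1 h2 => ?_⟩
  · have hk' : 1 ∈ Finset.Icc 1 k := Finset.mem_Icc.2 ⟨le_rfl, hk⟩
    rw [h.contract_eq_zero_iff (isLift_rep P) hk', form_eq P hk']
    exact H hk'
  · have := H (Finset.mem_Icc.1 hk).2
    rw [h.contract_eq_zero_iff (isLift_rep P) hk, form_eq P hk] at this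
    exact this
  · have h1' : j ∈ Finset.Icc 1 k := Finset.mem_Icc.2 ⟨h1, by omega⟩
    have h2' : j + 1 ∈ Finset.Icc 1 k := Finset.mem_Icc.2 ⟨by omega, h2⟩
    rw [h.rel_iff (isLift_rep P) h1' h2', form_eq P h1', form_eq P h2']
    exact H j h1' h2'
  · have := H j (Finset.mem_Icc.1 h1).1 (Finset.mem_Icc.1 h2).2
    rw [h.rel_iff (isLift_rep P) h1 h2, form_eq P h1, form_eq P h2] at this
    exact this

theorem mem_vanishLocus_iff {i : ℕ} (hi : i + 1 ∈ S) (h : IsLift x b P) :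
    P ∈ vanishLocus i hi ↔ contract x (b (i + 1)) = 0 := by
  rw [h.contract_eq_zero_iff (isLift_rep P) hi, form_eq P hi]
  rfl

end

/-! ### Affine charts -/

/-- The points at which the coordinate `x α` and the coordinates `b j (s j)` do not vanish. -/
def chart (S : Finset ℕ) (α : Fin 3) (s : ∀ j, Sym (Fin 3) j) : Set (JetAmbient S) :=
  {P | P.x α ≠ 0 ∧ ∀ j ∈ S, P.form j (s j) ≠ 0}

/-- The affine coordinates of the point `x` in a chart. -/
def affX (α : Fin 3) (P : JetAmbient S) : Fin 3 → ℂ := fun i => P.x i / P.x α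

/-- The affine coordinates of the forms `b j` in a chart. -/
def affB (s : ∀ j, Sym (Fin 3) j) (P : JetAmbient S) (j : ℕ) : SymForm j :=
  fun t => P.form j t / P.form j (s j)

section Chart

variable {α : Fin 3} {s : ∀ j, Sym (Fin 3) j} {P : JetAmbient S}

theorem exists_mem_chart (P : JetAmbient S) : ∃ α s, P ∈ chart S α s := by
  obtain ⟨α, hα⟩ := Function.ne_iff.1 (isLift_rep P).x_ne_zero
  have : ∀ j, ∃ t : Sym (Fin 3) j, j ∈ S → P.form j t ≠ 0 := fun j => by
    by_cases hj : j ∈ S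
    · obtain ⟨t, ht⟩ := Function.ne_iff.1 ((isLift_rep P).b_ne_zero hj)
      exact ⟨t, fun _ => ht⟩
    -- The family `s` is indexed by all naturals; its values off `S` play no role.
    · exact ⟨Classical.arbitrary _, fun h => absurd h hj⟩
  choose s hs using this
  exact ⟨α, s, hα, hs⟩

theorem isOpen_chart (S : Finset ℕ) (α : Fin 3) (s : ∀ j, Sym (Fin 3) j) :
    IsOpen (chart S α s) := by
  refine isOpen_iff_mem_nhds.2 fun P hP => ?_
  have h1 := eventually_rep_ne (X := Set.univ) (P := P) (i := Sum.inl ()) hP.1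
  have h2 : ∀ᶠ Q in 𝓝[Set.univ] P, ∀ j ∈ S, Q.form j (s j) ≠ 0 := by
    rw [Filter.eventually_all_finset]
    intro j hj
    have h := hP.2 j hj
    rw [form_eq P hj] at h
    filter_upwards [eventually_rep_ne (X := Set.univ) (P := P) (i := Sum.inr ⟨j, hj⟩) h] with Q hQ
    rw [form_eq Q hj]
    exact hQ
  rw [nhdsWithin_univ] at h1 h2
  filter_upwards [h1, h2] with Q a b using ⟨a, b⟩

theorem affX_self (hP : P ∈ chart S α s) : affX α P α = 1 := div_self hP.1

theorem affB_self (hP : P ∈ chart S α s) {j : ℕ} (hj : j ∈ S) : affB s P j (s j) = 1 :=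
  div_self (hP.2 j hj)

theorem isLift_aff (hP : P ∈ chart S α s) : IsLift (affX α P) (affB s P) P := by
  constructor
  · have : affX α P = (P.x α)⁻¹ • P.x := funext fun i => div_eq_inv_mul _ _
    rw [this]
    exact (isLift_rep P).1.smul (inv_ne_zero hP.1)
  · intro j hj
    have : affB s P j = (P.form j (s j))⁻¹ • P.form j := funext fun i => div_eq_inv_mul _ _
    rw [this]
    exact ((isLift_rep P).2 j hj).smul (inv_ne_zero (hP.2 j hj))

theorem regular_affX (hP : P ∈ chart S α s) {X : Set (JetAmbient S)} (i : Fin 3) :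
    RegularWithinAt (fun Q : JetAmbient S => affX α Q i) X P :=
  regularWithinAt_ratio (n := jetCoord S) (X := X) (P := P) (i := Sum.inl ()) i (c := α) hP.1

theorem regular_affB (hP : P ∈ chart S α s) {X : Set (JetAmbient S)} (j : ℕ)
    (t : Sym (Fin 3) j) : RegularWithinAt (fun Q : JetAmbient S => affB s Q j t) X P := by
  by_cases hj : j ∈ S
  · have h := hP.2 j hj
    rw [form_eq P hj] at h
    simp only [affB, form_eq _ hj]
    exact regularWithinAt_ratio (n := jetCoord S) (X := X) (P := P) (i := Sum.inr ⟨j, hj⟩) t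
      (c := s j) h
  · simp only [affB, JetAmbient.form, dif_neg hj]
    simpa using regularWithinAt_const 0

end Chart

theorem RegularWithinAt.contract {ι : Type} {n : ι → Type} {X : Set (MultiProj n)}
    {P : MultiProj n} {x : MultiProj n → Fin 3 → ℂ} {p : ℕ} {Ω : MultiProj n → SymForm (p + 1)}
    (hx : ∀ i, RegularWithinAt (fun Q => x Q i) X P)
    (hΩ : ∀ t, RegularWithinAt (fun Q => Ω Q t) X P) (s : Sym (Fin 3) p) :
    RegularWithinAt (fun Q => contract (x Q) (Ω Q) s) X P :=
  RegularWithinAt.sum _ fun i _ => (hΩ (i ::ₛ s)).mul (hx i)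

theorem locRepAt_jet {ι : Type} {n : ι → Type} {X : Set (MultiProj n)} {P : MultiProj n}
    {φ : MultiProj n → JetAmbient S} {x : MultiProj n → Fin 3 → ℂ}
    {b : MultiProj n → ∀ j, SymForm j} (hx : ∀ i, RegularWithinAt (fun Q => x Q i) X P)
    (hb : ∀ j ∈ S, ∀ t, RegularWithinAt (fun Q => b Q j t) X P)
    (h : ∀ᶠ Q in 𝓝[X] P, IsLift (x Q) (b Q) (φ Q)) : LocRepAt φ X P := by
  refine ⟨fun i => match i with
    | Sum.inl _ => fun t Q => x Q t
    | Sum.inr j => fun t Q => b Q j t, ?_, ?_⟩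
  · rintro (⟨⟩ | ⟨j, hj⟩) t
    · exact hx t
    · exact hb j hj t
  · filter_upwards [h] with Q hQ
    rintro (⟨⟩ | ⟨j, hj⟩)
    · exact hQ.1
    · exact hQ.2 j hj

theorem locRepAt_forget (hTS : T ⊆ S) (X : Set (JetAmbient S)) (P : JetAmbient S) :
    LocRepAt (forget hTS) X P := by
  obtain ⟨α, s, hP⟩ := exists_mem_chart P
  refine locRepAt_jet (x := affX α) (b := affB s) (fun i => regular_affX hP i)
    (fun j _ t => regular_affB hP j t) ?_
  filter_upwards [mem_nhdsWithin_of_mem_nhds ((isOpen_chart S α s).mem_nhds hP)] with Q hQ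
  exact (isLift_aff hQ).forget hTS

/-! ### Closed conditions -/

theorem isClosed_contract_eq_zero {j : ℕ} (hj : j + 1 ∈ S) :
    IsClosed {P : JetAmbient S | contract P.x (P.form (j + 1)) = 0} := by
  refine isClosed_of_regular fun P => ?_
  obtain ⟨α, s, hP⟩ := exists_mem_chart P
  refine ⟨_, Sym (Fin 3) j, fun t Q => contract (affX α Q) (affB s Q (j + 1)) t,
    isOpen_chart S α s, hP, fun t => ?_, fun Q hQ => ?_⟩
  · exact RegularWithinAt.contract (regular_affX hP) (regular_affB hP _) t
  · rw [Set.mem_ofPred_eq, (isLift_rep Q).contract_eq_zero_iff (isLift_aff hQ) hj]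
    exact funext_iff

theorem isClosed_rel {j : ℕ} (hj : j ∈ S) (hj' : j + 1 ∈ S) :
    IsClosed {P : JetAmbient S | Rel P.x (P.form (j + 1)) (P.form j)} := by
  refine isClosed_of_regular fun P => ?_
  obtain ⟨α, s, hP⟩ := exists_mem_chart P
  have h := RegularWithinAt.contract (X := Set.univ) (regular_affX hP) (regular_affB hP (j + 1))
  refine ⟨_, Sym (Fin 3) j, fun t Q => contract (affX α Q) (affB s Q (j + 1)) t -
    contract (affX α Q) (affB s Q (j + 1)) (s j) * affB s Q j t,
    isOpen_chart S α s, hP, fun t => ?_, fun Q hQ => ?_⟩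
  · exact (h t).sub ((h (s j)).mul (regular_affB hP j t))
  · rw [Set.mem_ofPred_eq, (isLift_rep Q).rel_iff (isLift_aff hQ) hj hj']
    exact rel_iff_coord (affB_self hQ hj)

theorem isClosed_rel_contract {j : ℕ} (hj : j ∈ S) (hj' : j + 1 + 1 ∈ S) :
    IsClosed {P : JetAmbient S | Rel P.x (contract P.x (P.form (j + 1 + 1))) (P.form j)} := by
  refine isClosed_of_regular fun P => ?_
  obtain ⟨α, s, hP⟩ := exists_mem_chart P
  have h := RegularWithinAt.contract (X := Set.univ) (regular_affX hP)
    (RegularWithinAt.contract (X := Set.univ) (regular_affX hP) (regular_affB hP (j + 1 + 1)))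
  refine ⟨_, Sym (Fin 3) j, fun t Q =>
    contract (affX α Q) (contract (affX α Q) (affB s Q (j + 1 + 1))) t -
    contract (affX α Q) (contract (affX α Q) (affB s Q (j + 1 + 1))) (s j) * affB s Q j t,
    isOpen_chart S α s, hP, fun t => ?_, fun Q hQ => ?_⟩
  · exact (h t).sub ((h (s j)).mul (regular_affB hP j t))
  · rw [Set.mem_ofPred_eq, (isLift_rep Q).rel_contract_iff (isLift_aff hQ) hj hj']
    exact rel_iff_coord (affB_self hQ hj)

theorem isClosed_vanishLocus {i : ℕ} (h : i + 1 ∈ S) : IsClosed (vanishLocus i h) := by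
  convert isClosed_contract_eq_zero h using 2
  ext P
  exact mem_vanishLocus_iff h (isLift_rep P)

theorem isClosed_PJet {k : ℕ} (hk : 1 ≤ k) : IsClosed (PJet k) := by
  have : PJet k = {P | contract P.x (P.form (0 + 1)) = 0} ∩
      ⋂ (j : ℕ) (_ : 1 ≤ j) (_ : j + 1 ≤ k), {P | Rel P.x (P.form (j + 1)) (P.form j)} := by
    ext P
    rw [mem_PJet_iff (isLift_rep P)]
    simp [hk]
  rw [this]
  refine (isClosed_contract_eq_zero (by simp [hk])).inter ?_
  refine isClosed_iInter fun j => isClosed_iInter fun h1 => isClosed_iInter fun h2 => ?_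
  exact isClosed_rel (Finset.mem_Icc.2 ⟨h1, by omega⟩) (Finset.mem_Icc.2 ⟨by omega, h2⟩)

end Jet

/-! ### Smoothness -/

section Smooth

open MvPolynomial

/-- Rescale `x` to `x α = 1` and take all free components zero. This surjectivity is the source of
smoothness. -/
theorem exists_contract_eq {p : ℕ} {x : Fin 3 → ℂ} (hx : x ≠ 0) (β : SymForm p) :
    ∃ Ω : SymForm (p + 1), contract x Ω = β := by
  obtain ⟨α, hα⟩ := Function.ne_iff.1 hx
  have hα : x α ≠ 0 := hα
  have h1 : ((x α)⁻¹ • x) α = 1 := by simp [hα]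
  refine ⟨recon ((x α)⁻¹ • x) α ((x α)⁻¹ • β) 0, ?_⟩
  have := contract_recon h1 ((x α)⁻¹ • β) 0
  rw [contract_smul_left] at this
  exact smul_right_injective _ (inv_ne_zero hα) this

variable (S : Finset ℕ)

/-- The coordinate functions of `x`. -/
def varX (i : Fin 3) : MvPolynomial (Σ i, jetCoord S i) ℂ := X ⟨Sum.inl (), i⟩

/-- The coordinate functions of `b j`. -/
def varB (j : ℕ) (t : Sym (Fin 3) j) : MvPolynomial (Σ i, jetCoord S i) ℂ :=
  if h : j ∈ S then X ⟨Sum.inr ⟨j, h⟩, t⟩ else 0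

/-- The components of the contraction of `b (j + 1)` with `x`. -/
def contractPoly (j : ℕ) (t : Sym (Fin 3) j) : MvPolynomial (Σ i, jetCoord S i) ℂ :=
  ∑ i, varB S (j + 1) (i ::ₛ t) * varX S i

/-- The local equations of the space of projectivized jets. -/
def jetEqn (s : ∀ j, Sym (Fin 3) j) (j : ℕ) (t : Sym (Fin 3) j) :
    MvPolynomial (Σ i, jetCoord S i) ℂ :=
  -- For `j = 0` this is `l(x) = 0`. For `j > 0` it is a minor of the pair `b (j + 1)(x)`, `b j`;
  -- the minors through the column `s j` suffice where `b j (s j) ≠ 0`.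
  if j = 0 then contractPoly S j t
  else contractPoly S j t * varB S j (s j) - contractPoly S j (s j) * varB S j t

theorem exists_isMultihom_varB (j : ℕ) : ∃ d, ∀ t, IsMultihom (varB S j t) d := by
  by_cases h : j ∈ S
  · refine ⟨Finsupp.single (Sum.inr ⟨j, h⟩) 1, fun t => ?_⟩
    rw [varB, dif_pos h]
    exact isMultihom_X _
  · refine ⟨0, fun t => ?_⟩
    rw [varB, dif_neg h]
    exact isWeightedHomogeneous_zero _ _ _

theorem exists_isMultihom_contractPoly (j : ℕ) :
    ∃ d, ∀ t, IsMultihom (contractPoly S j t) d := by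
  obtain ⟨d, hd⟩ := exists_isMultihom_varB S (j + 1)
  exact ⟨d + Finsupp.single (Sum.inl ()) 1, fun t =>
    IsWeightedHomogeneous.sum _ _ _ fun i _ => (hd _).mul (isMultihom_X _)⟩

theorem exists_isMultihom_jetEqn (s : ∀ j, Sym (Fin 3) j) (j : ℕ) (t : Sym (Fin 3) j) :
    ∃ d, IsMultihom (jetEqn S s j t) d := by
  obtain ⟨d, hd⟩ := exists_isMultihom_contractPoly S j
  obtain ⟨d', hd'⟩ := exists_isMultihom_varB S j
  rw [jetEqn]
  split_ifs
  · exact ⟨d, hd t⟩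
  · exact ⟨d + d', ((hd t).mul (hd' _)).sub ((hd _).mul (hd' t))⟩

variable {S}

theorem evalAt_varX (P : JetAmbient S) (i : Fin 3) : evalAt (varX S i) P = P.x i := eval_X _

theorem evalAt_varB (P : JetAmbient S) (j : ℕ) (t : Sym (Fin 3) j) :
    evalAt (varB S j t) P = P.form j t := by
  by_cases h : j ∈ S
  · rw [varB, dif_pos h, form_eq P h]
    exact eval_X _
  · rw [varB, dif_neg h, JetAmbient.form, dif_neg h]
    exact map_zero _

theorem evalAt_contractPoly (P : JetAmbient S) (j : ℕ) (t : Sym (Fin 3) j) :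
    evalAt (contractPoly S j t) P = contract P.x (P.form (j + 1)) t := by
  rw [contractPoly, evalAt, map_sum]
  refine Finset.sum_congr rfl fun i _ => ?_
  rw [← evalAt_varX, ← evalAt_varB, ← evalAt_mul]
  rfl

theorem evalAt_jetEqn (s : ∀ j, Sym (Fin 3) j) (P : JetAmbient S) (j : ℕ) (t : Sym (Fin 3) j) :
    evalAt (jetEqn S s j t) P = if j = 0 then contract P.x (P.form (j + 1)) t
      else contract P.x (P.form (j + 1)) t * P.form j (s j) -
        contract P.x (P.form (j + 1)) (s j) * P.form j t := by
  rw [jetEqn]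
  split_ifs
  · exact evalAt_contractPoly P j t
  · rw [← evalAt_contractPoly, ← evalAt_contractPoly, ← evalAt_varB, ← evalAt_varB, ← evalAt_mul,
      ← evalAt_mul]
    exact map_sub _ _ _

/-- The derivative at `P` in the direction of a form `v` in the `j`-th factor. -/
def dirDeriv (P : JetAmbient S) {j : ℕ} (hj : j ∈ S) (v : SymForm j) :
    MvPolynomial (Σ i, jetCoord S i) ℂ →ₗ[ℂ] ℂ where
  toFun F := ∑ t : Sym (Fin 3) j, v t * evalAt (pderiv ⟨Sum.inr ⟨j, hj⟩, t⟩ F) P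
  map_add' F G := by simp [evalAt, mul_add, Finset.sum_add_distrib]
  map_smul' c F := by
    rw [RingHom.id_apply, smul_eq_mul, Finset.mul_sum]
    refine Finset.sum_congr rfl fun t _ => ?_
    rw [Derivation.map_smul, evalAt, evalAt, smul_eval]
    ring

section

variable {P : JetAmbient S} {j : ℕ} {hj : j ∈ S} {v : SymForm j}

theorem dirDeriv_apply (F : MvPolynomial (Σ i, jetCoord S i) ℂ) : dirDeriv P hj v F =
    ∑ t : Sym (Fin 3) j, v t * evalAt (pderiv ⟨Sum.inr ⟨j, hj⟩, t⟩ F) P := rfl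

theorem dirDeriv_mul (F G : MvPolynomial (Σ i, jetCoord S i) ℂ) :
    dirDeriv P hj v (F * G) =
      dirDeriv P hj v F * evalAt G P + evalAt F P * dirDeriv P hj v G := by
  simp only [dirDeriv_apply, Derivation.leibniz, Finset.sum_mul, Finset.mul_sum,
    ← Finset.sum_add_distrib]
  refine Finset.sum_congr rfl fun t _ => ?_
  simp only [evalAt, map_add, smul_eq_mul, map_mul]
  ring

theorem dirDeriv_varX (i : Fin 3) : dirDeriv P hj v (varX S i) = 0 := by
  classical
  refine Finset.sum_eq_zero fun t _ => ?_
  rw [varX, pderiv_X_of_ne fun h => Sum.inl_ne_inr (congrArg Sigma.fst h), evalAt, map_zero, mul_zero]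

theorem dirDeriv_varB_self (t : Sym (Fin 3) j) : dirDeriv P hj v (varB S j t) = v t := by
  classical
  rw [dirDeriv_apply, varB, dif_pos hj, Finset.sum_eq_single t]
  · simp [evalAt]
  · intro t' _ h
    have hne : (⟨Sum.inr ⟨j, hj⟩, t⟩ : Σ i, jetCoord S i) ≠ ⟨Sum.inr ⟨j, hj⟩, t'⟩ :=
      fun h' => h.symm (eq_of_heq (Sigma.mk.inj h').2)
    rw [pderiv_X_of_ne hne, evalAt, map_zero, mul_zero]
  · simp

theorem dirDeriv_varB_of_ne {j' : ℕ} (h : j' ≠ j) (t : Sym (Fin 3) j') :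
    dirDeriv P hj v (varB S j' t) = 0 := by
  classical
  rw [varB]
  split_ifs with hj'
  · refine Finset.sum_eq_zero fun t' _ => ?_
    rw [pderiv_X_of_ne (by
      intro h'
      have := congrArg Sigma.fst h'
      simp only [Sum.inr.injEq, Subtype.mk.injEq] at this
      exact h this), evalAt, map_zero, mul_zero]
  · exact map_zero _

end

section

variable {P : JetAmbient S} {j : ℕ} {hj : j + 1 ∈ S} {v : SymForm (j + 1)}

theorem dirDeriv_contractPoly_self (t : Sym (Fin 3) j) :
    dirDeriv P hj v (contractPoly S j t) = contract P.x v t := by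
  rw [contractPoly, map_sum]
  refine Finset.sum_congr rfl fun i _ => ?_
  rw [dirDeriv_mul, dirDeriv_varX, dirDeriv_varB_self, evalAt_varX, mul_zero, add_zero]

theorem dirDeriv_contractPoly_of_ne {j' : ℕ} (h : j' ≠ j) (t : Sym (Fin 3) j') :
    dirDeriv P hj v (contractPoly S j' t) = 0 := by
  rw [contractPoly, map_sum]
  refine Finset.sum_eq_zero fun i _ => ?_
  rw [dirDeriv_mul, dirDeriv_varX, dirDeriv_varB_of_ne (by omega), zero_mul, mul_zero, add_zero]

theorem dirDeriv_jetEqn_self (s : ∀ j, Sym (Fin 3) j) (t : Sym (Fin 3) j) :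
    dirDeriv P hj v (jetEqn S s j t) = if j = 0 then contract P.x v t
      else contract P.x v t * P.form j (s j) - contract P.x v (s j) * P.form j t := by
  rw [jetEqn]
  split_ifs
  · exact dirDeriv_contractPoly_self t
  · rw [map_sub, dirDeriv_mul, dirDeriv_mul, dirDeriv_contractPoly_self,
      dirDeriv_contractPoly_self, dirDeriv_varB_of_ne (by omega), dirDeriv_varB_of_ne (by omega),
      evalAt_varB, evalAt_varB, mul_zero, mul_zero, add_zero, add_zero]

/-- The equation of level `j'` involves no form of degree above `j' + 1`; this makes the Jacobian
block triangular. -/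
theorem dirDeriv_jetEqn_of_lt (s : ∀ j, Sym (Fin 3) j) {j' : ℕ} (h : j' < j)
    (t : Sym (Fin 3) j') : dirDeriv P hj v (jetEqn S s j' t) = 0 := by
  rw [jetEqn]
  split_ifs
  · exact dirDeriv_contractPoly_of_ne h.ne t
  · rw [map_sub, dirDeriv_mul, dirDeriv_mul, dirDeriv_contractPoly_of_ne h.ne,
      dirDeriv_contractPoly_of_ne h.ne, dirDeriv_varB_of_ne (by omega),
      dirDeriv_varB_of_ne (by omega)]
    simp

end

theorem rel_iff_minors {p : ℕ} {x : Fin 3 → ℂ} {Ω : SymForm (p + 1)} {β : SymForm p}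
    {s : Sym (Fin 3) p} (hs : β s ≠ 0) :
    Rel x Ω β ↔ ∀ t, t ≠ s → contract x Ω t * β s - contract x Ω s * β t = 0 := by
  constructor
  · rintro ⟨c, hc⟩ t -
    simp [hc]
    ring
  · intro h
    refine ⟨contract x Ω s / β s, funext fun t => ?_⟩
    rw [Pi.smul_apply, smul_eq_mul, div_mul_eq_mul_div, eq_div_iff hs]
    by_cases ht : t = s
    · rw [ht]
    · exact sub_eq_zero.1 (h t ht)

/-- The indices of the local equations. -/
abbrev EqnIndex (k : ℕ) (s : ∀ j, Sym (Fin 3) j) : Type :=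
  -- The minor with `t = s j` is identically zero and would destroy independence. At level `0`
  -- nothing is dropped.
  Σ j : Fin k, {t : Sym (Fin 3) (j : ℕ) // (j : ℕ) ≠ 0 → t ≠ s j}

theorem mem_PJet_iff_jetEqn {k : ℕ} {α : Fin 3} {s : ∀ j, Sym (Fin 3) j}
    {P : JetAmbient (Finset.Icc 1 k)} (hP : P ∈ chart _ α s) :
    P ∈ PJet k ↔ ∀ i : EqnIndex k s, evalAt (jetEqn (Finset.Icc 1 k) s i.1 i.2.1) P = 0 := by
  rw [mem_PJet_iff (isLift_rep P)]
  simp only [evalAt_jetEqn]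
  constructor
  · rintro ⟨h0, h⟩ ⟨⟨j, hj⟩, t, ht⟩
    dsimp only at t ht ⊢
    split_ifs with hj0
    · subst hj0
      exact congrFun (h0 hj) t
    · exact (rel_iff_minors (hP.2 j (Finset.mem_Icc.2 ⟨by omega, hj.le⟩))).1
        (h j (by omega) hj) t (ht hj0)
  · refine fun h => ⟨fun hk => funext fun t => ?_, fun j h1 h2 => ?_⟩
    · exact h ⟨⟨0, hk⟩, t, fun h => absurd rfl h⟩
    · rw [rel_iff_minors (hP.2 j (Finset.mem_Icc.2 ⟨by omega, by omega⟩))]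
      intro t ht
      have := h ⟨⟨j, h2⟩, t, fun _ => ht⟩
      rwa [if_neg (show j ≠ 0 by omega)] at this

/-- Differentiate a linear relation in the direction of `b (j + 1)`: lower levels drop out by
triangularity, and higher levels by descending induction on `j`. Surjectivity of contraction then
isolates one equation of level `j`. -/
theorem linearIndependent_jetEqn {k : ℕ} {α : Fin 3} {s : ∀ j, Sym (Fin 3) j}
    {P : JetAmbient (Finset.Icc 1 k)} (hP : P ∈ chart _ α s) :
    LinearIndependent ℂ (fun (i : EqnIndex k s) (c : Σ i, jetCoord (Finset.Icc 1 k) i) =>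
      evalAt (pderiv c (jetEqn (Finset.Icc 1 k) s i.1 i.2.1)) P) := by
  classical
  rw [Fintype.linearIndependent_iff]
  intro g hg
  have key : ∀ {j : ℕ} (hj : j ∈ Finset.Icc 1 k) (v : SymForm j),
      ∑ i : EqnIndex k s, g i * dirDeriv P hj v (jetEqn (Finset.Icc 1 k) s i.1 i.2.1) = 0 := by
    intro j hj v
    simp only [dirDeriv_apply, Finset.mul_sum]
    rw [Finset.sum_comm]
    refine Finset.sum_eq_zero fun t _ => ?_
    have := congrFun hg ⟨Sum.inr ⟨j, hj⟩, t⟩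
    rw [Finset.sum_apply] at this
    rw [← mul_zero (v t), ← Pi.zero_apply (M := fun _ => ℂ), ← this, Finset.mul_sum]
    exact Finset.sum_congr rfl fun i _ => by simp; ring
  intro i
  induction hN : k - i.1 using Nat.strong_induction_on generalizing i with
  | _ N ih =>
    obtain ⟨⟨j, hj⟩, t, ht⟩ := i
    dsimp only at t ht hN
    -- With `v(x)` the indicator of `t`, only the equation `t` survives at level `j`; for `j > 0`
    -- the component of `v(x)` at `s j` is zero because `t ≠ s j`.
    obtain ⟨v, hv⟩ := exists_contract_eq (isLift_rep P).x_ne_zero (Pi.single t 1)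
    have hj1 : j + 1 ∈ Finset.Icc 1 k := Finset.mem_Icc.2 ⟨by omega, hj⟩
    have h := key hj1 v
    rw [Fintype.sum_eq_single ⟨⟨j, hj⟩, t, ht⟩] at h
    · rw [dirDeriv_jetEqn_self, hv] at h
      split_ifs at h with hj0
      · simpa using h
      · rw [Pi.single_eq_same, Pi.single_eq_of_ne (ht hj0).symm] at h
        simpa [hP.2 j (Finset.mem_Icc.2 ⟨by omega, hj.le⟩)] using h
    · rintro ⟨⟨j', hj'⟩, t', ht'⟩ hne
      rcases lt_trichotomy j' j with h | rfl | h
      · rw [dirDeriv_jetEqn_of_lt s h, mul_zero]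
      · have htt : t' ≠ t := by
          rintro rfl
          exact hne rfl
        rw [dirDeriv_jetEqn_self, hv, Pi.single_eq_of_ne htt]
        split_ifs with hj0
        · simp
        · rw [Pi.single_eq_of_ne (ht hj0).symm]
          simp
      · rw [ih (k - j') (by omega) ⟨⟨j', hj'⟩, t', ht'⟩ rfl, zero_mul]

theorem isSmoothVariety_PJet (k : ℕ) : IsSmoothVariety (PJet k) := by
  classical
  intro P _
  obtain ⟨α, s, hP⟩ := exists_mem_chart P
  let e := (Fintype.equivFin (EqnIndex k s)).symm
  refine ⟨_, fun j => jetEqn _ s (e j).1 (e j).2.1, fun j => exists_isMultihom_jetEqn _ s _ _,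
    ?_, (linearIndependent_jetEqn hP).comp e e.injective⟩
  filter_upwards [(isOpen_chart _ α s).mem_nhds hP] with Q hQ
  rw [mem_PJet_iff_jetEqn hQ]
  exact (e.forall_congr_right (q := fun i => evalAt (jetEqn _ s i.1 i.2.1) Q = 0)).symm

end Smooth

/-! ### Maps to and from a product with a projective space -/

section Product

variable {ι κ : Type} {n : ι → Type} {m : κ → Type} {r : ℕ}

theorem pair_fstPt_sndPt (Q : MultiProj (withProj m r)) : pair (fstPt Q) (sndPt Q) = Q := by
  funext s
  rcases s with i | ⟨⟩ <;> rfl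

theorem locRepAt_fstPt [Finite κ] (X : Set (MultiProj (withProj m r)))
    (Q : MultiProj (withProj m r)) : LocRepAt fstPt X Q := by
  have : ∀ i : κ, ∃ c : m i, Projectivization.rep (K := ℂ) (V := m i → ℂ) (fstPt Q i) c ≠ 0 :=
    fun i => Function.ne_iff.1 (Projectivization.rep_nonzero _)
  choose c hc using this
  refine ⟨fun i t R => Projectivization.rep (K := ℂ) (V := m i → ℂ) (fstPt R i) t /
    Projectivization.rep (K := ℂ) (V := m i → ℂ) (fstPt R i) (c i), fun i t => ?_, ?_⟩
  · exact regularWithinAt_ratio (n := withProj m r) (X := X) (P := Q) (i := Sum.inl i) t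
      (c := c i) (hc i)
  · rw [Filter.eventually_all]
    intro i
    filter_upwards [eventually_rep_ne (n := withProj m r) (X := X) (P := Q) (i := Sum.inl i)
      (c := c i) (hc i)] with R hR
    exact ⟨_, inv_ne_zero hR, funext fun t => div_eq_inv_mul _ _⟩

theorem LocRepAt.prod {φ : MultiProj n → MultiProj (withProj m r)} {X : Set (MultiProj n)}
    {P : MultiProj n} (h : LocRepAt (fun Q => fstPt (φ Q)) X P)
    {v : MultiProj n → Fin (r + 1) → ℂ} (hv : ∀ a, RegularWithinAt (fun Q => v Q a) X P)
    (hφ : ∀ᶠ Q in 𝓝[X] P, Lifts (v Q) (sndPt (φ Q))) : LocRepAt φ X P := by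
  obtain ⟨q, hq, e⟩ := h
  refine ⟨fun i => match i with
    | Sum.inl i => q i
    | Sum.inr _ => fun a Q => v Q a, ?_, ?_⟩
  · rintro (i | ⟨⟩) t
    · exact hq i t
    · exact hv t
  · filter_upwards [e, hφ] with Q h1 h2
    rintro (i | ⟨⟩)
    · exact h1 i
    · exact h2

/-- The functions on `X` that are regular at `P`. -/
def regularAt (X : Set (MultiProj n)) (P : MultiProj n) : AddSubgroup (MultiProj n → ℂ) where
  carrier := {g | RegularWithinAt g X P}
  zero_mem' := regularWithinAt_const 0
  add_mem' := RegularWithinAt.add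
  neg_mem' := RegularWithinAt.neg

section

variable {X : Set (MultiProj n)} {P : MultiProj n} {x : MultiProj n → Fin 3 → ℂ} {α : Fin 3} {p : ℕ}

theorem RegularWithinAt.fibreCoord {Ω : MultiProj n → SymForm (p + 1)} {s : Sym (Fin 3) p}
    (hx : ∀ i, RegularWithinAt (fun Q => x Q i) X P)
    (hΩ : ∀ t, RegularWithinAt (fun Q => Ω Q t) X P) (a : Fin (p + 1 + 1 + 1)) :
    RegularWithinAt (fun Q => fibreCoord (x Q) α s (Ω Q) a) X P := by
  obtain ⟨o, rfl⟩ := (fibreIndex α p).symm.surjective a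
  cases o with
  | none => simpa [JetVar.fibreCoord] using RegularWithinAt.contract hx hΩ s
  | some t => simpa [JetVar.fibreCoord] using hΩ t.1

theorem RegularWithinAt.fibreForm {β : MultiProj n → SymForm p}
    {v : MultiProj n → Fin (p + 1 + 1 + 1) → ℂ}
    (hx : ∀ i, RegularWithinAt (fun Q => x Q i) X P)
    (hβ : ∀ t, RegularWithinAt (fun Q => β Q t) X P)
    (hv : ∀ t, RegularWithinAt (fun Q => v Q t) X P) (t : Sym (Fin 3) (p + 1)) :
    RegularWithinAt (fun Q => fibreForm (x Q) α (β Q) (v Q) t) X P :=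
  fibreForm_mem (regularAt X P) (fun j _ hg => (hx j).mul hg) (fun j _ hg => (hβ j).mul hg) hv t

end

end Product

/-! ### Local trivializations -/

/-- `T` arises from `S` by removing `p + 1`, and contains `p`. -/
structure Drops (S T : Finset ℕ) (p : ℕ) : Prop where
  sub : T ⊆ S
  mem_of_ne : ∀ j ∈ S, j ≠ p + 1 → j ∈ T
  pred_mem : p ∈ T
  mem : p + 1 ∈ S
  notMem : p + 1 ∉ T

section Trivialization

variable {S T : Finset ℕ} {p : ℕ} {α : Fin 3} {s : ∀ j, Sym (Fin 3) j}

/-- The map `(x, (b j)) ↦ ((x, (b j)_{j ≠ p + 1}), [b (p + 1)])` in linear coordinates of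
`b (p + 1)`. -/
def triv (hTS : T ⊆ S) (p : ℕ) (α : Fin 3) (s : ∀ j, Sym (Fin 3) j) (P : JetAmbient S) :
    MultiProj (withProj (jetCoord T) (p + 1 + 1)) :=
  pair (forget hTS P) (toProj (fibreCoord (affX α (forget hTS P)) α (s p) (P.form (p + 1))))

/-- The form with given linear coordinates over a point in a chart. -/
def formAt (p : ℕ) (α : Fin 3) (s : ∀ j, Sym (Fin 3) j) (y : JetAmbient T)
    (v : Fin (p + 1 + 1 + 1) → ℂ) : SymForm (p + 1) :=
  fibreForm (affX α y) α (affB s y p) v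

/-- The inverse of `triv`. -/
def trivInv (S : Finset ℕ) (p : ℕ) (α : Fin 3) (s : ∀ j, Sym (Fin 3) j)
    (Q : MultiProj (withProj (jetCoord T) (p + 1 + 1))) : JetAmbient S :=
  mkJet S (affX α (fstPt Q : JetAmbient T)) (Function.update (affB s (fstPt Q : JetAmbient T))
    (p + 1) (formAt p α s (fstPt Q : JetAmbient T) (sndPt Q).rep))

/-- The domain of a local trivialization. -/
def trivDomain (hTS : T ⊆ S) (p : ℕ) (α : Fin 3) (s : ∀ j, Sym (Fin 3) j) :
    Set (JetAmbient S) :=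
  {P | Rel P.x (P.form (p + 1)) (P.form p) ∧ forget hTS P ∈ chart T α s}

theorem Drops.isLift_update (H : Drops S T p) {P : JetAmbient S} {x : Fin 3 → ℂ}
    {b : ∀ j, SymForm j} {Ω : SymForm (p + 1)} (h : IsLift x b (forget H.sub P))
    (hΩ : Lifts (n := Sym (Fin 3) (p + 1)) Ω (P (Sum.inr ⟨p + 1, H.mem⟩))) :
    IsLift x (Function.update b (p + 1) Ω) P := by
  refine ⟨h.1, fun j hj => ?_⟩
  by_cases hjp : j = p + 1
  · subst hjp
    rw [Function.update_self]
    exact hΩ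
  · rw [Function.update_of_ne hjp]
    exact h.2 j (H.mem_of_ne j hj hjp)

theorem Drops.isLift_mkJet (H : Drops S T p) {y : JetAmbient T} {x : Fin 3 → ℂ}
    {b : ∀ j, SymForm j} (h : IsLift x b y) {Ω : SymForm (p + 1)} (hΩ : Ω ≠ 0) :
    IsLift x (Function.update b (p + 1) Ω) (mkJet S x (Function.update b (p + 1) Ω)) := by
  refine JetVar.isLift_mkJet h.x_ne_zero fun j hj => ?_
  by_cases hjp : j = p + 1
  · subst hjp
    rwa [Function.update_self]
  · rw [Function.update_of_ne hjp]
    exact h.b_ne_zero (H.mem_of_ne j hj hjp)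

theorem Drops.forget_eq (H : Drops S T p) {y : JetAmbient T} {P : JetAmbient S} {x : Fin 3 → ℂ}
    {b : ∀ j, SymForm j} (h : IsLift x b y) {Ω : SymForm (p + 1)}
    (hP : IsLift x (Function.update b (p + 1) Ω) P) : forget H.sub P = y := by
  refine (hP.forget H.sub).unique (h.congr fun j hj => Function.update_of_ne ?_ _ _)
  rintro rfl
  exact H.notMem hj

theorem Drops.rel_iff (H : Drops S T p) {P : JetAmbient S} {x : Fin 3 → ℂ}
    {b : ∀ j, SymForm j} {Ω : SymForm (p + 1)}
    (h : IsLift x (Function.update b (p + 1) Ω) P) :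
    Rel P.x (P.form (p + 1)) (P.form p) ↔ Rel x Ω (b p) := by
  rw [(isLift_rep P).rel_iff h (H.sub H.pred_mem) H.mem, Function.update_self,
    Function.update_of_ne (by omega)]

theorem formAt_ne_zero (hp : p ∈ T) {y : JetAmbient T} (hy : y ∈ chart T α s)
    {v : Fin (p + 1 + 1 + 1) → ℂ} (hv : v ≠ 0) : formAt p α s y v ≠ 0 :=
  fibreForm_ne_zero (affX_self hy) (affB_self hy hp) hv

theorem rel_formAt {y : JetAmbient T} (hy : y ∈ chart T α s)
    (v : Fin (p + 1 + 1 + 1) → ℂ) : Rel (affX α y) (formAt p α s y v) (affB s y p) :=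
  rel_fibreForm (affX_self hy) v

theorem Drops.isLift_trivInv (H : Drops S T p)
    {Q : MultiProj (withProj (jetCoord T) (p + 1 + 1))} {y : JetAmbient T} (hQ : fstPt Q = y)
    (hy : y ∈ chart T α s) :
    IsLift (affX α y) (Function.update (affB s y) (p + 1) (formAt p α s y (sndPt Q).rep))
      (trivInv S p α s Q) := by
  subst hQ
  exact H.isLift_mkJet (isLift_aff hy)
    (formAt_ne_zero H.pred_mem hy (Projectivization.rep_nonzero _))

theorem Drops.forget_trivInv (H : Drops S T p)
    {Q : MultiProj (withProj (jetCoord T) (p + 1 + 1))} {y : JetAmbient T} (hQ : fstPt Q = y)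
    (hy : y ∈ chart T α s) : forget H.sub (trivInv S p α s Q) = y :=
  H.forget_eq (isLift_aff hy) (H.isLift_trivInv hQ hy)

theorem Drops.trivInv_mem (H : Drops S T p)
    {Q : MultiProj (withProj (jetCoord T) (p + 1 + 1))} {y : JetAmbient T} (hQ : fstPt Q = y)
    (hy : y ∈ chart T α s) : trivInv S p α s Q ∈ trivDomain H.sub p α s := by
  refine ⟨(H.rel_iff (H.isLift_trivInv hQ hy)).2 (rel_formAt hy _), ?_⟩
  rwa [H.forget_trivInv hQ hy]

/-- By linearity of `fibreCoord` any representative of `b (p + 1)` will do. Its coordinates are not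
all zero, since they determine the form on the fibre space. -/
theorem Drops.lifts_sndPt_triv (H : Drops S T p) {P : JetAmbient S}
    (hP : P ∈ trivDomain H.sub p α s) {Ω : SymForm (p + 1)}
    (hΩ : Lifts (n := Sym (Fin 3) (p + 1)) Ω (P (Sum.inr ⟨p + 1, H.mem⟩))) :
    Lifts (fibreCoord (affX α (forget H.sub P)) α (s p) Ω) (sndPt (triv H.sub p α s P)) := by
  have h0 : Lifts (n := Sym (Fin 3) (p + 1)) (P.form (p + 1)) (P (Sum.inr ⟨p + 1, H.mem⟩)) :=
    (isLift_rep P).2 _ H.mem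
  obtain ⟨c, hc, rfl⟩ := hΩ.exists_smul h0
  rw [map_smul]
  refine (lifts_toProj ?_).smul hc
  have h1 := (H.rel_iff (H.isLift_update (isLift_aff hP.2) h0)).1 hP.1
  exact fibreCoord_ne_zero (affX_self hP.2) (affB_self hP.2 H.pred_mem) h1 h0.ne_zero

theorem Drops.triv_trivInv (H : Drops S T p)
    {Q : MultiProj (withProj (jetCoord T) (p + 1 + 1))} {y : JetAmbient T} (hQ : fstPt Q = y)
    (hy : y ∈ chart T α s) : triv H.sub p α s (trivInv S p α s Q) = Q := by
  have h := H.lifts_sndPt_triv (H.trivInv_mem hQ hy) ((H.isLift_trivInv hQ hy).2 _ H.mem)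
  rw [Function.update_self, H.forget_trivInv hQ hy, formAt,
    fibreCoord_fibreForm (affX_self hy) (affB_self hy H.pred_mem)] at h
  rw [← pair_fstPt_sndPt Q, ← pair_fstPt_sndPt (triv H.sub p α s _)]
  congr 1
  · rw [pair_fstPt_sndPt, hQ]
    exact H.forget_trivInv hQ hy
  · rw [pair_fstPt_sndPt]
    exact h.unique (lifts_rep _)

theorem Drops.trivInv_triv (H : Drops S T p) {P : JetAmbient S}
    (hP : P ∈ trivDomain H.sub p α s) : trivInv S p α s (triv H.sub p α s P) = P := by
  have hy : forget H.sub P ∈ chart T α s := hP.2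
  have h0 : Lifts (n := Sym (Fin 3) (p + 1)) (P.form (p + 1)) (P (Sum.inr ⟨p + 1, H.mem⟩)) :=
    (isLift_rep P).2 _ H.mem
  have h1 := (H.rel_iff (H.isLift_update (isLift_aff hy) h0)).1 hP.1
  refine (H.isLift_trivInv (y := forget H.sub P) rfl hy).unique
    (H.isLift_update (isLift_aff hy) ?_)
  obtain ⟨c, hc, h⟩ := (lifts_rep _).exists_smul (H.lifts_sndPt_triv hP h0)
  rw [formAt, h, fibreForm_smul (affX_self hy),
    fibreForm_fibreCoord (affX_self hy) (affB_self hy H.pred_mem) h1]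
  exact h0.smul hc

theorem Drops.locRepAt_triv (H : Drops S T p) {P : JetAmbient S} {X : Set (JetAmbient S)}
    (hX : X ⊆ trivDomain H.sub p α s) (hP : P ∈ X) : LocRepAt (triv H.sub p α s) X P := by
  -- The chart on `T` singles out no nonzero component of `b (p + 1)`, so a second chart, on `S`,
  -- supplies regular coordinates of that form.
  obtain ⟨α', s', hP'⟩ := exists_mem_chart P
  have hf := locRepAt_forget H.sub X P
  refine LocRepAt.prod (v := fun Q => fibreCoord (affX α (forget H.sub Q)) α (s p)
    (affB s' Q (p + 1))) hf ?_ ?_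
  · refine RegularWithinAt.fibreCoord (fun i => ?_) (regular_affB hP' _)
    exact hf.regular_comp hP (Set.mapsTo_univ _ _) (regular_affX (hX hP).2 i)
  · filter_upwards [mem_nhdsWithin_of_mem_nhds ((isOpen_chart S α' s').mem_nhds hP'),
      self_mem_nhdsWithin] with Q h1 h2
    exact H.lifts_sndPt_triv (hX h2) ((isLift_aff h1).2 _ H.mem)

theorem Drops.locRepAt_trivInv (H : Drops S T p)
    {E : Set (MultiProj (withProj (jetCoord T) (p + 1 + 1)))}
    (hE : ∀ Q ∈ E, fstPt Q ∈ chart T α s)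
    {Q : MultiProj (withProj (jetCoord T) (p + 1 + 1))} (hQ : Q ∈ E) :
    LocRepAt (trivInv S p α s) E Q := by
  have hf := locRepAt_fstPt E Q
  have hx : ∀ i, RegularWithinAt
      (fun R : MultiProj (withProj (jetCoord T) (p + 1 + 1)) => affX α (S := T) (fstPt R) i) E Q :=
    fun i => hf.regular_comp hQ (Set.mapsTo_univ _ _) (regular_affX (hE Q hQ) i)
  have hb : ∀ j t, RegularWithinAt
      (fun R : MultiProj (withProj (jetCoord T) (p + 1 + 1)) => affB s (S := T) (fstPt R) j t)
      E Q :=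
    fun j t => hf.regular_comp hQ (Set.mapsTo_univ _ _) (regular_affB (hE Q hQ) j t)
  obtain ⟨c, hc⟩ := Function.ne_iff.1 (Projectivization.rep_nonzero (sndPt Q))
  have hc : (sndPt Q).rep c ≠ 0 := hc
  -- The chosen representative of `sndPt R` need not vary regularly. Its quotient by the coordinate
  -- `c` does, and this only rescales the form.
  refine locRepAt_jet (x := fun R => affX α (S := T) (fstPt R))
    (b := fun R => Function.update (affB s (S := T) (fstPt R)) (p + 1)
      (formAt p α s (fstPt R : JetAmbient T) (((sndPt R).rep c)⁻¹ • (sndPt R).rep)))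
    hx (fun j _ t => ?_) ?_
  · by_cases hj : j = p + 1
    · subst hj
      simp only [Function.update_self]
      refine RegularWithinAt.fibreForm hx (hb p) (fun a => ?_) t
      simp only [Pi.smul_apply, smul_eq_mul, ← div_eq_inv_mul]
      exact regularWithinAt_ratio (n := withProj (jetCoord T) (p + 1 + 1)) (X := E) (P := Q)
        (i := Sum.inr ()) a (c := c) hc
    · simp only [Function.update_of_ne hj]
      exact hb j t
  · filter_upwards [eventually_rep_ne (n := withProj (jetCoord T) (p + 1 + 1)) (X := E) (P := Q)
      (i := Sum.inr ()) (c := c) hc, self_mem_nhdsWithin] with R h1 h2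
    have hy := hE R h2
    have h := H.isLift_trivInv (S := S) (Q := R) rfl hy
    refine H.isLift_update ?_ ?_
    · rw [H.forget_trivInv rfl hy]
      exact isLift_aff hy
    · rw [formAt, fibreForm_smul (affX_self hy)]
      have := h.2 _ H.mem
      rw [Function.update_self] at this
      exact this.smul (inv_ne_zero h1)

/-- `triv` is an isomorphism between subsets that correspond to each other. -/
theorem Drops.isIsoOn_triv (H : Drops S T p) {X : Set (JetAmbient S)}
    {E : Set (MultiProj (withProj (jetCoord T) (p + 1 + 1)))}
    (hX : X ⊆ trivDomain H.sub p α s) (hE : ∀ Q ∈ E, fstPt Q ∈ chart T α s)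
    (hXE : Set.MapsTo (triv H.sub p α s) X E) (hEX : Set.MapsTo (trivInv S p α s) E X) :
    IsIsoOn (triv H.sub p α s) (trivInv S p α s) X E :=
  ⟨isMorphismOn_of_locRep hXE fun _ hP => H.locRepAt_triv hX hP,
    isMorphismOn_of_locRep hEX fun _ hQ => H.locRepAt_trivInv hE hQ,
    fun _ hP => H.trivInv_triv (hX hP), fun Q hQ => H.triv_trivInv rfl (hE Q hQ)⟩

/-- The linear isomorphism between the coordinates on a fibre with respect to two charts. -/
def fibreTransition (hp : p ∈ T) {α' : Fin 3} {s' : ∀ j, Sym (Fin 3) j} {y : JetAmbient T}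
    (hy : y ∈ chart T α s) (hy' : y ∈ chart T α' s') :
    (Fin (p + 1 + 1 + 1) → ℂ) ≃ₗ[ℂ] (Fin (p + 1 + 1 + 1) → ℂ) :=
  -- The charts rescale `x` and `b p` only, so both coordinate systems live on the same space of
  -- forms.
  have hrel : ∀ Ω, Rel (affX α y) Ω (affB s y p) ↔ Rel (affX α' y) Ω (affB s' y p) := fun Ω => by
    obtain ⟨c, hc, h⟩ := (isLift_aff hy).1.exists_smul (isLift_aff hy').1
    obtain ⟨d, hd, h'⟩ := ((isLift_aff hy).2 p hp).exists_smul ((isLift_aff hy').2 p hp)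
    rw [h, h']
    simpa using rel_smul_iff (Ω := Ω) hc one_ne_zero hd
  { toFun := fun v => fibreCoord (affX α' y) α' (s' p) (formAt p α s y v)
    invFun := fun v => fibreCoord (affX α y) α (s p) (formAt p α' s' y v)
    map_add' := fun v w => by
      rw [formAt, fibreForm_add (affX_self hy), map_add]
      rfl
    map_smul' := fun c v => by
      rw [formAt, fibreForm_smul (affX_self hy), map_smul]
      rfl
    left_inv := fun v => by
      dsimp only
      rw [formAt, fibreForm_fibreCoord (affX_self hy') (affB_self hy' hp)
        ((hrel _).1 (rel_formAt hy _)), formAt,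
        fibreCoord_fibreForm (affX_self hy) (affB_self hy hp)]
    right_inv := fun v => by
      dsimp only
      rw [formAt, fibreForm_fibreCoord (affX_self hy) (affB_self hy hp)
        ((hrel _).2 (rel_formAt hy' _)), formAt,
        fibreCoord_fibreForm (affX_self hy') (affB_self hy' hp)] }

theorem Drops.sndPt_triv_trivInv (H : Drops S T p) {α' : Fin 3} {s' : ∀ j, Sym (Fin 3) j}
    {y : JetAmbient T} (hy : y ∈ chart T α s) (hy' : y ∈ chart T α' s')
    (v : ℙ ℂ (Fin (p + 1 + 1 + 1) → ℂ)) :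
    sndPt (triv H.sub p α' s' (trivInv S p α s (pair y v))) =
      Projectivization.map (fibreTransition H.pred_mem hy hy').toLinearMap
        (fibreTransition H.pred_mem hy hy').injective v := by
  have hmem := H.trivInv_mem (S := S) (Q := pair y v) rfl hy
  have hP : trivInv S p α s (pair y v) ∈ trivDomain H.sub p α' s' := by
    refine ⟨hmem.1, ?_⟩
    rwa [H.forget_trivInv (Q := pair y v) rfl hy]
  have h := H.lifts_sndPt_triv hP ((H.isLift_trivInv (Q := pair y v) rfl hy).2 _ H.mem)
  rw [Function.update_self, H.forget_trivInv (Q := pair y v) rfl hy] at h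
  refine h.unique ?_
  conv_rhs => rw [← v.mk_rep, Projectivization.map_mk]
  exact lifts_mk _ _

end Trivialization

/-! ### The projective bundle -/

theorem drops_Icc {p : ℕ} (hp : 1 ≤ p) : Drops (Finset.Icc 1 (p + 1)) (Finset.Icc 1 p) p where
  sub := Finset.Icc_subset_Icc_right (Nat.le_succ p)
  mem_of_ne j hj h := by
    rw [Finset.mem_Icc] at hj ⊢
    omega
  pred_mem := Finset.mem_Icc.2 ⟨hp, le_rfl⟩
  mem := Finset.mem_Icc.2 ⟨by omega, le_rfl⟩
  notMem h := by
    rw [Finset.mem_Icc] at h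
    omega

theorem mem_PJet_succ_iff {p : ℕ} (hp : 1 ≤ p) {P : JetAmbient (Finset.Icc 1 (p + 1))} :
    P ∈ PJet (p + 1) ↔ forget (drops_Icc hp).sub P ∈ PJet p ∧
      Rel P.x (P.form (p + 1)) (P.form p) := by
  rw [mem_PJet_iff (isLift_rep P), mem_PJet_iff ((isLift_rep P).forget _)]
  constructor
  · rintro ⟨h0, h⟩
    exact ⟨⟨fun _ => h0 (by omega), fun j h1 h2 => h j h1 (by omega)⟩, h p hp le_rfl⟩
  · rintro ⟨⟨h0, h⟩, h'⟩
    refine ⟨fun _ => h0 hp, fun j h1 h2 => ?_⟩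
    rcases Nat.lt_or_ge j p with hj | hj
    · exact h j h1 hj
    · obtain rfl : j = p := by omega
      exact h'

/-- The only condition on the new form is `b (p + 1)(x) ∼ b p`, so over a chart `triv` maps onto the
full product with `ℙ^(p+2)`. -/
theorem isProjectiveBundle_PJet {p : ℕ} (hp : 1 ≤ p) :
    IsProjectiveBundle (forget (drops_Icc hp).sub) (PJet (p + 1)) (PJet p) (p + 1 + 1) := by
  have H := drops_Icc hp
  refine ⟨isMorphismOn_of_locRep (fun P hP => ((mem_PJet_succ_iff hp).1 hP).1)
    fun P _ => locRepAt_forget _ _ _, Fin 3 × (∀ j, Sym (Fin 3) j),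
    fun a => chart _ a.1 a.2, fun a => triv H.sub p a.1 a.2, fun a => trivInv _ p a.1 a.2,
    fun a => isOpen_chart _ _ _, fun y _ => ?_, fun a => ?_, fun a P _ => rfl, ?_⟩
  · obtain ⟨α, s, hy⟩ := exists_mem_chart y
    exact Set.mem_iUnion.2 ⟨(α, s), hy⟩
  · refine H.isIsoOn_triv (fun P hP => ⟨((mem_PJet_succ_iff hp).1 hP.1).2, hP.2⟩)
      (fun Q hQ => hQ.2) (fun P hP => ⟨((mem_PJet_succ_iff hp).1 hP.1).1, hP.2⟩) fun Q hQ => ?_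
    have h := H.trivInv_mem (S := Finset.Icc 1 (p + 1)) (Q := Q) rfl hQ.2
    refine ⟨(mem_PJet_succ_iff hp).2 ⟨?_, h.1⟩, h.2⟩
    rw [H.forget_trivInv (Q := Q) rfl hQ.2]
    exact hQ.1
  · exact fun a b u hu => ⟨fibreTransition H.pred_mem hu.1.2 hu.2,
      fun v => H.sndPt_triv_trivInv hu.1.2 hu.2 v⟩

/-! ### Deformations of jets -/

section Deform

variable {p : ℕ} {x : Fin 3 → ℂ} {α : Fin 3} {κ : ℕ → ℂ}

/-- Forms `δ j` with `δ j = 0` for `j ≤ p`, `δ (p + 1) = d` and `δ (j + 1)(x) = κ j • δ j` for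
`j > p`. -/
def deform (x : Fin 3 → ℂ) (α : Fin 3) (κ : ℕ → ℂ) (d : SymForm (p + 1)) : ∀ j, SymForm j
  | 0 => 0
  -- The updated family contributes `d` in degree `p + 1` only. Above it, `recon` with zero free
  -- components is a section of contraction and carries the change to the next degree.
  | j + 1 => Function.update (fun j => (0 : SymForm j)) (p + 1) d (j + 1) +
      (if p + 1 ≤ j then κ j else 0) • recon x α (deform x α κ d j) 0

theorem deform_of_le (d : SymForm (p + 1)) {j : ℕ} (hj : j ≤ p) : deform x α κ d j = 0 := by
  cases j with
  | zero => rfl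
  | succ j => rw [deform, Function.update_of_ne (by omega), if_neg (by omega), zero_smul, add_zero]

theorem deform_self (d : SymForm (p + 1)) : deform x α κ d (p + 1) = d := by
  rw [deform, Function.update_self, if_neg (by omega), zero_smul, add_zero]

theorem contract_deform (hx : x α = 1) (d : SymForm (p + 1)) {j : ℕ} (hj : p + 1 ≤ j) :
    contract x (deform x α κ d (j + 1)) = κ j • deform x α κ d j := by
  rw [deform, Function.update_of_ne (by omega), if_pos hj, zero_add, contract_smul,
    contract_recon hx]

theorem deform_smul (hx : x α = 1) (c : ℂ) (d : SymForm (p + 1)) (j : ℕ) :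
    deform x α κ (c • d) j = c • deform x α κ d j := by
  induction j with
  | zero => simp [deform]
  | succ j ih =>
    have h : recon x α (c • deform x α κ d j) 0 = c • recon x α (deform x α κ d j) 0 := by
      simpa using recon_smul hx c (deform x α κ d j) 0
    rw [deform, deform, ih, h, smul_add, smul_comm]
    congr 1
    by_cases hj : j = p
    · subst hj
      simp
    · rw [Function.update_of_ne (by omega), Function.update_of_ne (by omega), smul_zero]

theorem deform_mem {A : Type*} (M : AddSubgroup (A → ℂ)) {x : A → Fin 3 → ℂ} {κ : A → ℕ → ℂ}
    {d : A → SymForm (p + 1)} (hx : ∀ j, ∀ g ∈ M, (fun Q => x Q j * g Q) ∈ M)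
    (hκ : ∀ j, ∀ g ∈ M, (fun Q => κ Q j * g Q) ∈ M) (hd : ∀ t, (fun Q => d Q t) ∈ M) (j : ℕ)
    (t : Sym (Fin 3) j) : (fun Q => deform (x Q) α (κ Q) (d Q) j t) ∈ M := by
  induction j with
  | zero => exact M.zero_mem
  | succ j ih =>
    rcases lt_trichotomy j p with hj | rfl | hj
    · convert M.zero_mem using 1
      ext Q
      rw [deform_of_le _ hj]
      rfl
    · simpa only [deform_self] using hd t
    · have := hκ j _ (recon_mem M (α := α) (w := fun _ => 0) hx ih (fun _ _ => M.zero_mem) t)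
      convert this using 1
      ext Q
      rw [deform, Function.update_of_ne (by omega), if_pos (by omega), zero_add]
      rfl

end Deform

/-! ### The image of the map that forgets one form -/

section Image

variable {k p : ℕ}

/-- The index set with `p + 1` removed. -/
abbrev dropIdx (k p : ℕ) : Finset ℕ := (Finset.Icc 1 k).erase (p + 1)

theorem mem_dropIdx {j : ℕ} : j ∈ dropIdx k p ↔ j ≠ p + 1 ∧ 1 ≤ j ∧ j ≤ k := by
  rw [Finset.mem_erase, Finset.mem_Icc]

theorem drops_erase (hp : 1 ≤ p) (hk : p + 1 + 1 ≤ k) :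
    Drops (Finset.Icc 1 k) (dropIdx k p) p where
  sub := Finset.erase_subset _ _
  mem_of_ne j hj h := Finset.mem_erase.2 ⟨h, hj⟩
  pred_mem := mem_dropIdx.2 (by omega)
  mem := Finset.mem_Icc.2 (by omega)
  notMem := Finset.notMem_erase _ _

/-- The equations of the image in homogeneous coordinates. -/
def ImageCond (k p : ℕ) (x : Fin 3 → ℂ) (b : ∀ j, SymForm j) : Prop :=
  contract x (b (0 + 1)) = 0 ∧
    (∀ j, 1 ≤ j → j + 1 ≤ k → j ≠ p → j ≠ p + 1 → Rel x (b (j + 1)) (b j)) ∧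
    Rel x (contract x (b (p + 1 + 1))) (b p)

/-- The image of the space of projectivized jets under the map that forgets `b (p + 1)`. -/
def jetImage (k p : ℕ) : Set (JetAmbient (dropIdx k p)) := {y | ImageCond k p y.x y.form}

theorem mem_jetImage_iff (hp : 1 ≤ p) (hk : p + 1 + 1 ≤ k) {y : JetAmbient (dropIdx k p)}
    {x : Fin 3 → ℂ} {b : ∀ j, SymForm j} (h : IsLift x b y) :
    y ∈ jetImage k p ↔ ImageCond k p x b := by
  have hr := isLift_rep y
  refine and_congr (hr.contract_eq_zero_iff h (mem_dropIdx.2 (by omega))) (and_congr ?_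
    (hr.rel_contract_iff h (mem_dropIdx.2 (by omega)) (mem_dropIdx.2 (by omega))))
  refine forall_congr' fun j => forall_congr' fun h1 => forall_congr' fun h2 =>
    forall_congr' fun h3 => forall_congr' fun h4 => ?_
  exact hr.rel_iff h (mem_dropIdx.2 (by omega)) (mem_dropIdx.2 (by omega))

theorem isClosed_jetImage (hp : 1 ≤ p) (hk : p + 1 + 1 ≤ k) : IsClosed (jetImage k p) := by
  have : jetImage k p = {y | contract y.x (y.form (0 + 1)) = 0} ∩
      ((⋂ (j : ℕ) (_ : 1 ≤ j) (_ : j + 1 ≤ k) (_ : j ≠ p) (_ : j ≠ p + 1),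
        {y | Rel y.x (y.form (j + 1)) (y.form j)}) ∩
      {y | Rel y.x (contract y.x (y.form (p + 1 + 1))) (y.form p)}) := by
    ext y
    simp [jetImage, ImageCond]
  rw [this]
  refine (isClosed_contract_eq_zero (mem_dropIdx.2 (by omega))).inter (IsClosed.inter ?_
    (isClosed_rel_contract (mem_dropIdx.2 (by omega)) (mem_dropIdx.2 (by omega))))
  refine isClosed_iInter fun j => isClosed_iInter fun h1 => isClosed_iInter fun h2 =>
    isClosed_iInter fun h3 => isClosed_iInter fun h4 => ?_
  exact isClosed_rel (mem_dropIdx.2 (by omega)) (mem_dropIdx.2 (by omega))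

/-- The relation between `b (p + 2)` and `b p` in the image is the composite of the two relations
through `b (p + 1)`. -/
theorem mem_PJet_iff_forget (hp : 1 ≤ p) (hk : p + 1 + 1 ≤ k) {P : JetAmbient (Finset.Icc 1 k)}
    {x : Fin 3 → ℂ} {b : ∀ j, SymForm j} (h : IsLift x b P) :
    P ∈ PJet k ↔ forget (drops_erase hp hk).sub P ∈ jetImage k p ∧
      Rel x (b (p + 1)) (b p) ∧ Rel x (b (p + 1 + 1)) (b (p + 1)) := by
  rw [mem_PJet_iff h, mem_jetImage_iff hp hk (h.forget _)]
  constructor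
  · rintro ⟨h0, h1⟩
    have h2 := h1 p hp (by omega)
    have h3 := h1 (p + 1) (by omega) hk
    refine ⟨⟨h0 (by omega), fun j a b _ _ => h1 j a b, ?_⟩, h2, h3⟩
    obtain ⟨c, hc⟩ := h2
    obtain ⟨d, hd⟩ := h3
    exact ⟨d * c, by rw [hd, contract_smul, hc, smul_smul]⟩
  · rintro ⟨⟨h0, h1, -⟩, h2, h3⟩
    refine ⟨fun _ => h0, fun j a b => ?_⟩
    by_cases hj : j = p
    · subst hj
      exact h2
    by_cases hj' : j = p + 1
    · subst hj'
      exact h3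
    exact h1 j a b hj hj'

theorem forget_image_PJet (hp : 1 ≤ p) (hk : p + 1 + 1 ≤ k) :
    forget (drops_erase hp hk).sub '' PJet k = jetImage k p := by
  have H := drops_erase hp hk
  refine Set.Subset.antisymm ?_ fun y hy => ?_
  · rintro _ ⟨P, hP, rfl⟩
    exact ((mem_PJet_iff_forget hp hk (isLift_rep P)).1 hP).1
  · obtain ⟨α, s, hc⟩ := exists_mem_chart y
    have hl := isLift_aff hc
    obtain ⟨Ω, h0, h1, h2⟩ : ∃ Ω : SymForm (p + 1), Ω ≠ 0 ∧ Rel (affX α y) Ω (affB s y p) ∧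
        Rel (affX α y) (affB s y (p + 1 + 1)) Ω := by
      -- A nonzero `b (p + 2)(x)` can itself serve as the missing form. If it vanishes, any nonzero
      -- form of the fibre space works, here the one with all coordinates `1`.
      by_cases h : contract (affX α y) (affB s y (p + 1 + 1)) = 0
      · exact ⟨formAt p α s y fun _ => 1,
          formAt_ne_zero H.pred_mem hc (Function.ne_iff.2 ⟨0, one_ne_zero⟩),
          rel_formAt hc _, 0, by rw [h, zero_smul]⟩
      · exact ⟨_, h, ((mem_jetImage_iff hp hk hl).1 hy).2.2, 1, (one_smul _ _).symm⟩
    have hP := H.isLift_mkJet hl h0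
    have hf := H.forget_eq hl hP
    refine ⟨_, (mem_PJet_iff_forget hp hk hP).2 ⟨?_, ?_, ?_⟩, hf⟩
    · rwa [hf]
    · rwa [Function.update_self, Function.update_of_ne (by omega)]
    · rwa [Function.update_self, Function.update_of_ne (by omega)]

end Image

/-! ### Deforming points of the image -/

section DeformImage

variable {k p : ℕ} {α : Fin 3} {s : ∀ j, Sym (Fin 3) j}

/-- The factors of proportionality between consecutive forms. -/
def ratios (p : ℕ) (s : ∀ j, Sym (Fin 3) j) (x : Fin 3 → ℂ) (b : ∀ j, SymForm j) (j : ℕ) : ℂ :=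
  -- The form `b (p + 1)` is absent; the value `1` makes `d` exactly the change of `b (p + 2)(x)`.
  if j = p + 1 then 1 else contract x (b (j + 1)) (s j)

/-- The deformation of the forms `b j` that changes `b (p + 2)(x)` by `d`. -/
def deformed (α : Fin 3) (s : ∀ j, Sym (Fin 3) j) (x : Fin 3 → ℂ) (b : ∀ j, SymForm j)
    (d : SymForm (p + 1)) (j : ℕ) : SymForm j :=
  b j + deform x α (ratios p s x b) d j

variable {x : Fin 3 → ℂ} {b : ∀ j, SymForm j} {d : SymForm (p + 1)}

theorem contract_deformed (hx : x α = 1) :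
    contract x (deformed α s x b d (p + 1 + 1)) = contract x (b (p + 1 + 1)) + d := by
  rw [deformed, contract_add, contract_deform hx _ le_rfl, deform_self, ratios, if_pos rfl,
    one_smul]

/-- Forms of degree at most `p` do not move. Above degree `p + 1` the correction obeys the same
proportionality, with the same factors, as the forms, so the sum does too. The condition on `b (p +
2)(x)` survives because `d` lies in the fibre space over `b p`. -/
theorem imageCond_deformed (hp : 1 ≤ p) (hx : x α = 1) (hb : ∀ j ∈ dropIdx k p, b j (s j) = 1)
    (h : ImageCond k p x b) (hd : Rel x d (b p)) : ImageCond k p x (deformed α s x b d) := by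
  obtain ⟨h0, h1, h2⟩ := h
  have hle : ∀ j ≤ p, deformed α s x b d j = b j := fun j hj => by
    rw [deformed, deform_of_le _ hj, add_zero]
  refine ⟨by rwa [hle _ (by omega)], fun j a c e f => ?_, ?_⟩
  · rcases Nat.lt_or_ge j p with hj | hj
    · rw [hle _ hj.le, hle _ hj]
      exact h1 j a c e f
    · refine ⟨contract x (b (j + 1)) (s j), ?_⟩
      rw [deformed, contract_add, contract_deform hx _ (by omega), deformed, smul_add, ratios,
        if_neg f]
      congr 1
      exact eq_coord_smul (hb j (mem_dropIdx.2 (by omega))) (h1 j a c e f)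
  · rw [contract_deformed hx, hle _ le_rfl]
    obtain ⟨c, hc⟩ := h2
    obtain ⟨c', hc'⟩ := hd
    exact ⟨c + c', by rw [contract_add, hc, hc', add_smul]⟩

end DeformImage

/-! ### Arbitrary lifts compared with chart coordinates -/

section Lift

variable {S : Finset ℕ} {α : Fin 3} {s : ∀ j, Sym (Fin 3) j} {P : JetAmbient S}
  {x : Fin 3 → ℂ} {b : ∀ j, SymForm j}

theorem IsLift.mem_chart (h : IsLift x b P) (hx : x α ≠ 0) (hb : ∀ j ∈ S, b j (s j) ≠ 0) :
    P ∈ chart S α s := by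
  constructor
  · obtain ⟨c, hc, rfl⟩ := h.1.exists_smul (isLift_rep P).1
    exact right_ne_zero_of_mul hx
  · intro j hj
    obtain ⟨c, hc, h'⟩ := (h.2 j hj).exists_smul ((isLift_rep P).2 j hj)
    have := hb j hj
    rw [h'] at this
    exact right_ne_zero_of_mul this

theorem IsLift.affX_eq (h : IsLift x b P) (hx : x α = 1) : affX α P = x := by
  obtain ⟨c, hc, h'⟩ := (isLift_rep P).1.exists_smul h.1
  ext i
  simp [affX, h', hx, hc]

theorem IsLift.affB_eq (h : IsLift x b P) {j : ℕ} (hj : j ∈ S) :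
    affB s P j = (b j (s j))⁻¹ • b j := by
  obtain ⟨c, hc, h'⟩ := ((isLift_rep P).2 j hj).exists_smul (h.2 j hj)
  ext i
  simp [affB, h', mul_div_mul_left _ _ hc, div_eq_inv_mul]

/-- The family of vectors of homogeneous coordinates given by `x` and the `b j`. -/
def jetVec (S : Finset ℕ) (x : Fin 3 → ℂ) (b : ∀ j, SymForm j) : ∀ i, jetCoord S i → ℂ
  | Sum.inl _ => x
  | Sum.inr j => b j

theorem IsLift.lifts_jetVec (h : IsLift x b P) (i) : Lifts (jetVec S x b i) (P i) := by
  rcases i with ⟨⟩ | ⟨j, hj⟩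
  · exact h.1
  · exact h.2 j hj

end Lift

/-- A curve with continuous homogeneous coordinates is continuous for the Zariski topology. -/
theorem tendsto_of_continuous_lifts {ι : Type} {n : ι → Type} {l : ℂ → ∀ i, n i → ℂ}
    (hl : ∀ i a, Continuous fun t => l t i a) {φ : ℂ → MultiProj n}
    (h : ∀ᶠ t in 𝓝 0, ∀ i, Lifts (l t i) (φ t i)) : Filter.Tendsto φ (𝓝 0) (𝓝 (φ 0)) := by
  rw [TopologicalSpace.tendsto_nhds_generateFrom_iff]
  rintro _ ⟨F, d, hF, rfl⟩ h0
  have hc : Continuous fun t => MvPolynomial.eval (fun c : Σ i, n i => l t c.1 c.2) F :=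
    (MvPolynomial.continuous_eval F).comp (continuous_pi fun c => hl c.1 c.2)
  obtain ⟨c, hc0, hcF⟩ := eval_lift h.self_of_nhds
  have hne : MvPolynomial.eval (fun c : Σ i, n i => l 0 c.1 c.2) F ≠ 0 := by
    rw [hcF F d hF]
    exact mul_ne_zero (hc0 d) h0
  filter_upwards [h, hc.continuousAt.eventually_ne hne] with t h1 h2
  obtain ⟨c, hc0, hcF⟩ := eval_lift h1
  rw [hcF F d hF] at h2
  exact right_ne_zero_of_mul h2

/-! ### The blowup -/

section Blowup

variable {k p : ℕ} {α : Fin 3} {s : ∀ j, Sym (Fin 3) j}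

/-- Generators of the ideal of the locus `b (p + 2)(x) = 0` in the image. -/
def blowGen (k p : ℕ) (α : Fin 3) (s : ∀ j, Sym (Fin 3) j) (a : Fin (p + 1 + 1 + 1))
    (y : JetAmbient (dropIdx k p)) : ℂ :=
  fibreCoord (affX α y) α (s p) (contract (affX α y) (affB s y (p + 1 + 1))) a

/-- The locus `b (p + 2)(x) = 0` in the image. -/
def blowCentre (k p : ℕ) (h : p + 1 + 1 ∈ dropIdx k p) : Set (JetAmbient (dropIdx k p)) :=
  jetImage k p ∩ vanishLocus (p + 1) h

theorem regular_blowGen {X : Set (JetAmbient (dropIdx k p))} {y : JetAmbient (dropIdx k p)}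
    (hy : y ∈ chart _ α s) (a : Fin (p + 1 + 1 + 1)) :
    RegularWithinAt (blowGen k p α s a) X y :=
  RegularWithinAt.fibreCoord (regular_affX hy)
    (RegularWithinAt.contract (regular_affX hy) (regular_affB hy _)) a

/-- On the image, `b (p + 2)(x)` lies in the fibre space over `b p`, so its linear coordinates
recover it. -/
theorem formAt_blowGen (hp : 1 ≤ p) (hk : p + 1 + 1 ≤ k) {y : JetAmbient (dropIdx k p)}
    (hy : y ∈ jetImage k p) (hc : y ∈ chart _ α s) :
    formAt p α s y (fun a => blowGen k p α s a y) =
      contract (affX α y) (affB s y (p + 1 + 1)) :=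
  fibreForm_fibreCoord (affX_self hc) (affB_self hc (drops_erase hp hk).pred_mem)
    ((mem_jetImage_iff hp hk (isLift_aff hc)).1 hy).2.2

theorem blowGen_eq_zero {y : JetAmbient (dropIdx k p)}
    (h : contract (affX α y) (affB s y (p + 1 + 1)) = 0) (a : Fin (p + 1 + 1 + 1)) :
    blowGen k p α s a y = 0 := by
  rw [blowGen, h, map_zero, Pi.zero_apply]

theorem contract_eq_zero_of_blowGen (hp : 1 ≤ p) (hk : p + 1 + 1 ≤ k)
    {y : JetAmbient (dropIdx k p)} (hy : y ∈ jetImage k p) (hc : y ∈ chart _ α s)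
    (h : ∀ a, blowGen k p α s a y = 0) : contract (affX α y) (affB s y (p + 1 + 1)) = 0 := by
  rw [← formAt_blowGen hp hk hy hc, funext h]
  have := fibreForm_smul (β := affB s y p) (affX_self hc) 0 0
  rw [zero_smul, zero_smul] at this
  exact this

/-! #### Generation of the ideal -/

/-- The deformation of the affine coordinates of `y` for which `b (p + 2)(x)` vanishes. -/
def retractForms (p : ℕ) (α : Fin 3) (s : ∀ j, Sym (Fin 3) j) (y : JetAmbient (dropIdx k p)) :
    ∀ j, SymForm j :=
  deformed α s (affX α y) (affB s y) (-contract (affX α y) (affB s y (p + 1 + 1)))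

/-- A local retraction of the image onto the locus `b (p + 2)(x) = 0`. -/
def retract (p : ℕ) (α : Fin 3) (s : ∀ j, Sym (Fin 3) j) (y : JetAmbient (dropIdx k p)) :
    JetAmbient (dropIdx k p) :=
  mkJet _ (affX α y) (retractForms p α s y)

theorem deform_zero {x : Fin 3 → ℂ} {κ : ℕ → ℂ} (hx : x α = 1) (j : ℕ) :
    deform x α κ (0 : SymForm (p + 1)) j = 0 := by
  simpa using deform_smul (κ := κ) hx 0 (0 : SymForm (p + 1)) j

theorem regular_ratios {X : Set (JetAmbient (dropIdx k p))} {y : JetAmbient (dropIdx k p)}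
    (hy : y ∈ chart _ α s) (j : ℕ) :
    RegularWithinAt (fun R : JetAmbient (dropIdx k p) => ratios p s (affX α R) (affB s R) j) X y := by
  by_cases hj : j = p + 1
  · simpa only [ratios, if_pos hj] using regularWithinAt_const 1
  · simpa only [ratios, if_neg hj] using
      RegularWithinAt.contract (regular_affX hy) (regular_affB hy _) _

theorem regular_retractForms {X : Set (JetAmbient (dropIdx k p))} {y : JetAmbient (dropIdx k p)}
    (hy : y ∈ chart _ α s) (j : ℕ) (t : Sym (Fin 3) j) :
    RegularWithinAt (fun R : JetAmbient (dropIdx k p) => retractForms p α s R j t) X y :=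
  (regular_affB hy j t).add <| deform_mem (regularAt X y) (x := fun R => affX α R)
    (κ := fun R => ratios p s (affX α R) (affB s R))
    (d := fun R => -contract (affX α R) (affB s R (p + 1 + 1)))
    (fun i _ hg => (regular_affX hy i).mul hg) (fun i _ hg => (regular_ratios hy i).mul hg)
    (fun t => (RegularWithinAt.contract (regular_affX hy) (regular_affB hy _) t).neg) j t

/-- The correction is linear in `b (p + 2)(x)`, which in turn is linear in the generators, with
regular coefficients in both cases. -/
theorem affB_sub_retractForms_mem (hp : 1 ≤ p) (hk : p + 1 + 1 ≤ k)
    {y : JetAmbient (dropIdx k p)} (hc : y ∈ chart _ α s) (j : ℕ)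
    (t : Sym (Fin 3) j) : (fun R => affB s R j t - retractForms p α s R j t) ∈
      idealAt (blowGen k p α s) (jetImage k p) y := by
  have hd : ∀ t, (fun R => contract (affX α R) (affB s R (p + 1 + 1)) t) ∈
      idealAt (blowGen k p α s) (jetImage k p) y := fun t => by
    refine idealAt_congr (fibreForm_mem _ (x := affX α) (α := α) (β := fun R => affB s R p)
      (v := fun R a => blowGen k p α s a R) (fun i _ hg => idealAt_mul (regular_affX hc i) hg)
      (fun t _ hg => idealAt_mul (regular_affB hc p t) hg) mem_idealAt_self t) ?_
    filter_upwards [self_mem_nhdsWithin,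
      mem_nhdsWithin_of_mem_nhds ((isOpen_chart _ α s).mem_nhds hc)] with R h1 h2
    exact (congrFun (formAt_blowGen hp hk h1 h2) t).symm
  have := deform_mem (idealAt (blowGen k p α s) (jetImage k p) y) (α := α)
    (x := fun R => affX α R) (κ := fun R => ratios p s (affX α R) (affB s R))
    (d := fun R => -contract (affX α R) (affB s R (p + 1 + 1)))
    (fun i _ hg => idealAt_mul (regular_affX hc i) hg)
    (fun i _ hg => idealAt_mul (regular_ratios hc i) hg) (fun t => neg_mem (hd t)) j t
  convert neg_mem this using 1
  ext R
  simp [retractForms, deformed]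

/-- At a point of the centre the correction is zero, so the retraction fixes it and the corrected
forms remain nonzero nearby. Cancelling `b (p + 2)(x)` puts the result in the centre. -/
theorem eventually_retract (hp : 1 ≤ p) (hk : p + 1 + 1 ≤ k)
    {y : JetAmbient (dropIdx k p)} (hy : y ∈ jetImage k p) (hc : y ∈ chart _ α s)
    (h0 : contract (affX α y) (affB s y (p + 1 + 1)) = 0) (hm : p + 1 + 1 ∈ dropIdx k p) :
    (∀ᶠ R in 𝓝[jetImage k p] y, IsLift (affX α R) (retractForms p α s R) (retract p α s R)) ∧
    Filter.Tendsto (retract p α s) (𝓝[jetImage k p] y) (𝓝[blowCentre k p hm] y) := by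
  have hself : retractForms p α s y = affB s y := by
    ext j t
    rw [retractForms, h0, neg_zero, deformed, deform_zero (affX_self hc), add_zero]
  have hlift : ∀ᶠ R in 𝓝[jetImage k p] y,
      IsLift (affX α R) (retractForms p α s R) (retract p α s R) := by
    have hne : ∀ᶠ R in 𝓝[jetImage k p] y,
        ∀ j ∈ dropIdx k p, retractForms p α s R j (s j) ≠ 0 := by
      rw [Filter.eventually_all_finset]
      intro j hj
      refine (regular_retractForms hc j (s j)).eventually_ne hy ?_
      rw [hself, affB_self hc hj]
      exact one_ne_zero
    filter_upwards [hne, mem_nhdsWithin_of_mem_nhds ((isOpen_chart _ α s).mem_nhds hc)]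
      with R h1 h2
    exact isLift_mkJet (isLift_aff h2).x_ne_zero
      fun j hj => Function.ne_iff.2 ⟨s j, h1 j hj⟩
  refine ⟨hlift, tendsto_nhdsWithin_iff.2 ⟨?_, ?_⟩⟩
  · have hρ : retract p α s y = y := by
      have := hlift.self_of_nhdsWithin hy
      rw [hself] at this
      exact this.unique (isLift_aff hc)
    have := (locRepAt_jet (X := jetImage k p) (regular_affX hc)
      (fun j _ t => regular_retractForms hc j t) hlift).tendsto hy
    rwa [hρ] at this
  · filter_upwards [hlift, self_mem_nhdsWithin,
      mem_nhdsWithin_of_mem_nhds ((isOpen_chart _ α s).mem_nhds hc)] with R h1 h2 h3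
    have hcond := (mem_jetImage_iff hp hk (isLift_aff h3)).1 h2
    refine ⟨(mem_jetImage_iff hp hk h1).2 (imageCond_deformed hp (affX_self h3)
      (fun j hj => affB_self h3 hj) hcond ?_), (mem_vanishLocus_iff _ h1).2 ?_⟩
    · obtain ⟨c, hc⟩ := hcond.2.2
      refine ⟨-c, ?_⟩
      have := contract_smul (affX α R) (-1) (contract (affX α R) (affB s R (p + 1 + 1)))
      rw [neg_one_smul, neg_one_smul] at this
      rw [this, hc, neg_smul]
    · rw [retractForms, contract_deformed (affX_self h3), add_neg_cancel]

/-- Off the centre some generator is a unit. At a point of the centre write `g = F / H`: `F`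
vanishes at the retracted point, whose coordinates agree with those of `R` modulo the generators, so
`F` is a combination of them. -/
theorem generatesIdealOn_blowGen (hp : 1 ≤ p) (hk : p + 1 + 1 ≤ k)
    (hm : p + 1 + 1 ∈ dropIdx k p) :
    GeneratesIdealOn (blowGen k p α s) (blowCentre k p hm) (jetImage k p) (chart _ α s) := by
  refine ⟨fun a u hu => regular_blowGen hu.2 a, fun a u hu => ?_, fun u hu g hg hg0 => ?_⟩
  · exact blowGen_eq_zero ((mem_vanishLocus_iff hm (isLift_aff hu.2)).1 hu.1.2) a
  change g ∈ idealAt (blowGen k p α s) (jetImage k p) u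
  obtain ⟨hy, hc⟩ := hu
  by_cases h : ∀ a, blowGen k p α s a u = 0
  swap
  · push Not at h
    obtain ⟨a, ha⟩ := h
    exact mem_idealAt_of_ne hg hy (regular_blowGen hc a) ha
  obtain ⟨hlift, htend⟩ := eventually_retract hp hk hy hc
    (contract_eq_zero_of_blowGen hp hk hy hc h) hm
  obtain ⟨d, F, H, hF, hH, e⟩ := hg
  let n : (Σ i, jetCoord (dropIdx k p) i) → JetAmbient (dropIdx k p) → ℂ :=
    fun c R => jetVec _ (affX α R) (affB s R) c.1 c.2
  let q : (Σ i, jetCoord (dropIdx k p) i) → JetAmbient (dropIdx k p) → ℂ :=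
    fun c R => jetVec _ (affX α R) (retractForms p α s R) c.1 c.2
  have hn : ∀ c, RegularWithinAt (n c) (jetImage k p) u := by
    rintro ⟨⟨⟩ | j, t⟩
    · exact regular_affX hc t
    · exact regular_affB hc j t
  have hq : ∀ c, RegularWithinAt (q c) (jetImage k p) u := by
    rintro ⟨⟨⟩ | j, t⟩
    · exact regular_affX hc t
    · exact regular_retractForms hc j t
  have hnq : ∀ c, (fun R => n c R - q c R) ∈
      idealAt (blowGen k p α s) (jetImage k p) u := by
    rintro ⟨⟨⟩ | j, t⟩
    · convert (idealAt (blowGen k p α s) (jetImage k p) u).zero_mem using 1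
      ext R
      exact sub_self _
    · exact affB_sub_retractForms_mem hp hk hc j t
  have hnl : ∀ R ∈ chart (dropIdx k p) α s, ∀ i, Lifts (fun t => n ⟨i, t⟩ R) (R i) :=
    fun R hR => (isLift_aff hR).lifts_jetVec
  have hev := e.self_of_nhdsWithin hy
  have hHu : MvPolynomial.eval (fun c => n c u) H ≠ 0 := by
    obtain ⟨c, hc0, hcF⟩ := eval_lift (hnl u hc)
    rw [hcF H d hH]
    exact mul_ne_zero (hc0 d) hev.1
  have hle : 𝓝[blowCentre k p hm] u ≤ 𝓝[jetImage k p] u :=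
    nhdsWithin_mono u Set.inter_subset_left
  have hFq : ∀ᶠ R in 𝓝[jetImage k p] u, MvPolynomial.eval (fun c => q c R) F = 0 := by
    filter_upwards [hlift, htend.eventually hg0, htend.eventually (e.filter_mono hle)]
      with R h1 h2 h3
    obtain ⟨c, hc0, hcF⟩ := eval_lift h1.lifts_jetVec
    have h4 : evalAt F (retract p α s R) = 0 := by
      have := h3.2.symm.trans h2
      exact (div_eq_zero_iff.1 this).resolve_right h3.1
    exact (hcF F d hF).trans (by rw [h4, mul_zero])
  refine idealAt_congr (idealAt_mul ((RegularWithinAt.eval hn H).inv hy hHu)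
    (eval_sub_eval_mem_idealAt hn hq hnq F)) ?_
  filter_upwards [hFq, e, mem_nhdsWithin_of_mem_nhds ((isOpen_chart _ α s).mem_nhds hc)]
    with R h1 h2 h3
  obtain ⟨c, hc0, hcF⟩ := eval_lift (hnl R h3)
  rw [h1, sub_zero, h2.2, hcF F d hF, hcF H d hH, ← div_eq_inv_mul,
    mul_div_mul_left _ _ (hc0 d)]

end Blowup

/-! ### The closure of the graph -/

section Graph

variable {k p : ℕ} {α : Fin 3} {s : ∀ j, Sym (Fin 3) j}

/-- The points `(y, v)` of the product such that the generators at `y` are proportional to `v`. -/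
def blowModel (k p : ℕ) (α : Fin 3) (s : ∀ j, Sym (Fin 3) j) :
    Set (MultiProj (withProj (jetCoord (dropIdx k p)) (p + 1 + 1))) :=
  {Q | fstPt Q ∈ jetImage k p ∩ chart _ α s ∧
    ∃ c : ℂ, (fun a => blowGen k p α s a (fstPt Q)) = c • (sndPt Q).rep}

/-- Proportionality to `v` is a closed condition: where `v c ≠ 0` it is the vanishing of the regular
functions `f a - f c * (v a / v c)`, which are zero on the graph. -/
theorem closure_ratGraph_subset :
    closure (ratGraph (blowGen k p α s) (jetImage k p) (chart _ α s)) ∩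
      {Q | fstPt Q ∈ jetImage k p ∩ chart _ α s} ⊆ blowModel k p α s := by
  rintro Q ⟨hQ, hy⟩
  refine ⟨hy, ?_⟩
  obtain ⟨c, hc⟩ := Function.ne_iff.1 (Projectivization.rep_nonzero (sndPt Q))
  have hc : (sndPt Q).rep c ≠ 0 := hc
  refine ⟨blowGen k p α s c (fstPt Q) / (sndPt Q).rep c, funext fun a => ?_⟩
  rw [Pi.smul_apply, smul_eq_mul, div_mul_eq_mul_div, mul_div_assoc, ← sub_eq_zero]
  by_contra hne
  have hgen : ∀ a, RegularWithinAt (fun R : MultiProj (withProj (jetCoord (dropIdx k p))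
      (p + 1 + 1)) => blowGen k p α s a (fstPt R)) Set.univ Q := fun a =>
    (locRepAt_fstPt Set.univ Q).regular_comp (Y := Set.univ) (Set.mem_univ _)
      (Set.mapsTo_univ _ _) (regular_blowGen hy.2 a)
  have hreg := (hgen a).sub ((hgen c).mul (regularWithinAt_ratio
    (n := withProj (jetCoord (dropIdx k p)) (p + 1 + 1)) (X := Set.univ) (P := Q)
    (i := Sum.inr ()) a (c := c) hc))
  have h1 := hreg.eventually_ne (Set.mem_univ _) hne
  have h2 := eventually_rep_ne (n := withProj (jetCoord (dropIdx k p)) (p + 1 + 1))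
    (X := Set.univ) (P := Q) (i := Sum.inr ()) (c := c) hc
  rw [nhdsWithin_univ] at h1 h2
  obtain ⟨R, ⟨u, hu, hu0, rfl⟩, h3, h4⟩ :=
    (mem_closure_iff_frequently.1 hQ).and_eventually (h1.and h2) |>.exists
  apply h3
  obtain ⟨d, hd, h⟩ := (lifts_rep _).exists_smul (lifts_mk _ hu0)
  generalize hw : Projectivization.mk ℂ _ hu0 = w at h h4 ⊢
  have hrep : ∀ a, w.rep a = d * blowGen k p α s a u := congrFun h
  change w.rep c ≠ 0 at h4
  change blowGen k p α s a u - blowGen k p α s c u * (w.rep a / w.rep c) = 0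
  rw [hrep] at h4
  have := right_ne_zero_of_mul h4
  rw [hrep, hrep]
  field_simp
  ring

/-- If the factor is nonzero the point is on the graph. Otherwise `y` is in the centre, and it is
approached along a curve in the image on which the generators are a nonzero multiple of `v` for
small `t ≠ 0`. -/
theorem blowModel_subset (hp : 1 ≤ p) (hk : p + 1 + 1 ≤ k) :
    blowModel k p α s ⊆ closure (ratGraph (blowGen k p α s) (jetImage k p) (chart _ α s)) := by
  rintro Q ⟨⟨hy, hc⟩, c, hcv⟩
  have hm : p + 1 + 1 ∈ dropIdx k p := mem_dropIdx.2 (by omega)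
  by_cases hc0 : c = 0
  swap
  · refine subset_closure ⟨fstPt Q, ⟨hy, hc⟩, ?_, ?_⟩
    · rw [hcv]
      exact smul_ne_zero hc0 (Projectivization.rep_nonzero _)
    · conv_lhs => rw [← pair_fstPt_sndPt Q]
      congr 1
      refine Lifts.unique (v := fun a => blowGen k p α s a (fstPt Q)) ?_ (lifts_mk _ _)
      rw [hcv]
      exact (lifts_rep _).smul hc0
  obtain ⟨y, hyQ⟩ : ∃ y : JetAmbient (dropIdx k p), fstPt Q = y := ⟨_, rfl⟩
  rw [hyQ] at hy hc
  have h0 : contract (affX α y) (affB s y (p + 1 + 1)) = 0 :=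
    contract_eq_zero_of_blowGen hp hk hy hc fun a => by
      have := congrFun hcv a
      rw [hc0, zero_smul, hyQ] at this
      exact this
  have hx := affX_self hc
  have hp' := (drops_erase hp hk).pred_mem
  -- Since `b (p + 2)(x)` vanishes at `t = 0`, along the curve it equals `t` times the form with
  -- coordinates `v`.
  let b : ℂ → ∀ j, SymForm j := fun t =>
    deformed α s (affX α y) (affB s y) (t • formAt p α s y (sndPt Q).rep)
  let δ : ∀ j, SymForm j := deform (affX α y) α (ratios p s (affX α y) (affB s y))
    (formAt p α s y (sndPt Q).rep)
  have hb : ∀ t j, b t j = affB s y j + t • δ j := fun t j => by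
    simp only [b, δ, deformed, deform_smul hx]
  have hcont : ∀ j (i : Sym (Fin 3) j), Continuous fun t => b t j i := fun j i => by
    simp only [hb, Pi.add_apply, Pi.smul_apply, smul_eq_mul]
    fun_prop
  have hb0 : b 0 = affB s y := funext fun j => by rw [hb, zero_smul, add_zero]
  have hne : ∀ᶠ t in 𝓝 (0 : ℂ), ∀ j ∈ dropIdx k p, b t j (s j) ≠ 0 := by
    rw [Filter.eventually_all_finset]
    intro j hj
    refine (hcont j (s j)).continuousAt.eventually_ne ?_
    rw [hb0, affB_self hc hj]
    exact one_ne_zero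
  have hlift : ∀ᶠ t in 𝓝 (0 : ℂ), IsLift (affX α y) (b t) (mkJet (dropIdx k p) (affX α y) (b t)) :=
    hne.mono fun t ht => isLift_mkJet (isLift_aff hc).x_ne_zero
      fun j hj => Function.ne_iff.2 ⟨s j, ht j hj⟩
  let φ : ℂ → MultiProj (withProj (jetCoord (dropIdx k p)) (p + 1 + 1)) := fun t =>
    pair (mkJet (dropIdx k p) (affX α y) (b t)) (sndPt Q)
  have hφ0 : φ 0 = Q := by
    have h := hlift.self_of_nhds
    rw [hb0] at h
    simp only [φ]
    rw [hb0, h.unique (isLift_aff hc), ← hyQ, pair_fstPt_sndPt]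
  -- A limit over the usual topology of `ℂ` suffices, because polynomials in continuous coordinates
  -- are continuous.
  have htend : Filter.Tendsto φ (𝓝[≠] 0) (𝓝 Q) := by
    rw [← hφ0]
    refine (tendsto_of_continuous_lifts (l := fun t i => match i with
      | Sum.inl i => jetVec _ (affX α y) (b t) i
      | Sum.inr _ => (sndPt Q).rep) ?_ ?_).mono_left nhdsWithin_le_nhds
    · rintro ((⟨⟩ | ⟨j, hj⟩) | ⟨⟩) a
      · exact continuous_const
      · exact hcont j a
      · exact continuous_const
    · filter_upwards [hlift] with t ht
      rintro (i | ⟨⟩)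
      · exact ht.lifts_jetVec i
      · exact lifts_rep _
  refine mem_closure_of_tendsto htend ?_
  filter_upwards [hne.filter_mono nhdsWithin_le_nhds, hlift.filter_mono nhdsWithin_le_nhds,
    self_mem_nhdsWithin] with t h1 h2 h3
  have h3 : t ≠ 0 := h3
  have hch : mkJet (dropIdx k p) (affX α y) (b t) ∈ chart _ α s :=
    h2.mem_chart (by rw [hx]; exact one_ne_zero) h1
  have hrel : Rel (affX α y) (t • formAt p α s y (sndPt Q).rep) (affB s y p) := by
    obtain ⟨e, he⟩ := rel_formAt (p := p) hc (sndPt Q).rep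
    exact ⟨t * e, by rw [contract_smul, he, smul_smul]⟩
  have himg : mkJet (dropIdx k p) (affX α y) (b t) ∈ jetImage k p :=
    (mem_jetImage_iff hp hk h2).2 (imageCond_deformed hp hx (fun j hj => affB_self hc hj)
      ((mem_jetImage_iff hp hk (isLift_aff hc)).1 hy) hrel)
  -- The generators use the normalised form, which accounts for the inverse of the component at `s
  -- (p + 2)`.
  have hgen : (fun a => blowGen k p α s a (mkJet (dropIdx k p) (affX α y) (b t))) =
      ((b t (p + 1 + 1) (s (p + 1 + 1)))⁻¹ * t) • (sndPt Q).rep := by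
    ext a
    rw [blowGen, h2.affX_eq hx, h2.affB_eq hm, contract_smul, contract_deformed hx, h0, zero_add,
      map_smul, map_smul, smul_smul, formAt, fibreCoord_fibreForm hx (affB_self hc hp')]
  have hs : (b t (p + 1 + 1) (s (p + 1 + 1)))⁻¹ * t ≠ 0 :=
    mul_ne_zero (inv_ne_zero (h1 _ hm)) h3
  refine ⟨_, ⟨himg, hch⟩, ?_, ?_⟩
  · rw [hgen]
    exact smul_ne_zero hs (Projectivization.rep_nonzero _)
  · simp only [φ]
    congr 1
    refine Lifts.unique (v := fun a => blowGen k p α s a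
      (mkJet (dropIdx k p) (affX α y) (b t))) ?_ (lifts_mk _ _)
    rw [hgen]
    exact (lifts_rep _).smul hs

theorem closure_ratGraph_eq (hp : 1 ≤ p) (hk : p + 1 + 1 ≤ k) :
    closure (ratGraph (blowGen k p α s) (jetImage k p) (chart _ α s)) ∩
      {Q | fstPt Q ∈ jetImage k p ∩ chart _ α s} = blowModel k p α s :=
  closure_ratGraph_subset.antisymm fun _ hQ => ⟨blowModel_subset hp hk hQ, hQ.1⟩

/-- The relation `b (p + 1)(x) ∼ b p` is built into `triv`; the one left, `b (p + 2)(x) ∼ b (p +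
1)`, says in linear coordinates that the generators are a multiple of `v`. -/
theorem isIsoOn_blowModel (hp : 1 ≤ p) (hk : p + 1 + 1 ≤ k) :
    IsIsoOn (triv (drops_erase hp hk).sub p α s) (trivInv (Finset.Icc 1 k) p α s)
      (PJet k ∩ forget (drops_erase hp hk).sub ⁻¹' chart _ α s) (blowModel k p α s) := by
  have H := drops_erase hp hk
  have hm : p + 1 + 1 ∈ dropIdx k p := mem_dropIdx.2 (by omega)
  have hX : PJet k ∩ forget (drops_erase hp hk).sub ⁻¹' chart _ α s ⊆ trivDomain H.sub p α s :=
    fun P hP => ⟨((mem_PJet_iff_forget hp hk (isLift_rep P)).1 hP.1).2.1, hP.2⟩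
  refine H.isIsoOn_triv hX (fun Q hQ => hQ.1.2) (fun P hP => ?_) fun Q hQ => ?_
  · have hc : forget H.sub P ∈ chart _ α s := hP.2
    have h0 : Lifts (n := Sym (Fin 3) (p + 1)) (P.form (p + 1)) (P (Sum.inr ⟨p + 1, H.mem⟩)) :=
      (isLift_rep P).2 _ H.mem
    have hl := H.isLift_update (isLift_aff hc) h0
    obtain ⟨h1, -, h2⟩ := (mem_PJet_iff_forget hp hk hl).1 hP.1
    rw [Function.update_self, Function.update_of_ne (by omega)] at h2
    obtain ⟨c, h2⟩ := h2
    obtain ⟨d, hd, h3⟩ := (H.lifts_sndPt_triv (hX hP) h0).exists_smul (lifts_rep _)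
    refine ⟨⟨h1, hc⟩, c * d, ?_⟩
    rw [← smul_smul, ← h3, ← map_smul, ← h2]
    rfl
  · obtain ⟨⟨hy, hc⟩, c, h⟩ := hQ
    have hl := H.isLift_trivInv (S := Finset.Icc 1 k) (Q := Q) rfl hc
    have hf := H.forget_trivInv (S := Finset.Icc 1 k) (Q := Q) rfl hc
    refine ⟨(mem_PJet_iff_forget hp hk hl).2 ⟨?_, ?_, ?_⟩, ?_⟩
    · rwa [hf]
    · rw [Function.update_self, Function.update_of_ne (by omega)]
      exact rel_formAt hc _
    · rw [Function.update_self, Function.update_of_ne (by omega)]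
      refine ⟨c, ?_⟩
      rw [← formAt_blowGen hp hk hy hc, h, formAt, fibreForm_smul (affX_self hc), formAt]
    · rw [Set.mem_preimage, hf]
      exact hc

theorem isBlowup_PJet (hp : 1 ≤ p) (hk : p + 1 + 1 ≤ k) (hm : p + 1 + 1 ∈ dropIdx k p) :
    IsBlowup (forget (drops_erase hp hk).sub) (PJet k) (jetImage k p)
      (jetImage k p ∩ vanishLocus (p + 1) hm) := by
  refine ⟨isMorphismOn_of_locRep
    (fun P hP => ((mem_PJet_iff_forget hp hk (isLift_rep P)).1 hP).1)
    fun P _ => locRepAt_forget _ _ _, ⟨_, isClosed_vanishLocus hm, rfl⟩, fun y _ => ?_⟩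
  obtain ⟨α, s, hc⟩ := exists_mem_chart y
  refine ⟨_, isOpen_chart _ α s, hc, p + 1 + 1, blowGen k p α s,
    generatesIdealOn_blowGen hp hk hm, triv (drops_erase hp hk).sub p α s,
    trivInv _ p α s, ?_, fun P _ => rfl⟩
  rw [closure_ratGraph_eq hp hk]
  exact isIsoOn_blowModel hp hk

end Graph

end JetVar

end

theorem mainTheorem10 (k : ℕ) (hk : 1 ≤ k) :
    (IsClosed (JetVar.PJet k) ∧ JetVar.IsSmoothVariety (JetVar.PJet k)) ∧
    (2 ≤ k →
      JetVar.IsProjectiveBundle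
        (JetVar.forget (Finset.Icc_subset_Icc_right (Nat.sub_le k 1)))
        (JetVar.PJet k) (JetVar.PJet (k - 1)) (k + 1)) ∧
    (∀ (i : ℕ) (hi : 2 ≤ i) (hik : i < k),
      IsClosed (JetVar.forget (Finset.erase_subset i (Finset.Icc 1 k)) '' JetVar.PJet k) ∧
      JetVar.IsBlowup
        (JetVar.forget (Finset.erase_subset i (Finset.Icc 1 k)))
        (JetVar.PJet k)
        (JetVar.forget (Finset.erase_subset i (Finset.Icc 1 k)) '' JetVar.PJet k)
        (JetVar.forget (Finset.erase_subset i (Finset.Icc 1 k)) '' JetVar.PJet k ∩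
          JetVar.vanishLocus i (Finset.mem_erase.mpr
            ⟨Nat.succ_ne_self i, Finset.mem_Icc.mpr ⟨Nat.succ_le_succ (Nat.zero_le i), hik⟩⟩))) := by
  refine ⟨⟨JetVar.isClosed_PJet hk, JetVar.isSmoothVariety_PJet k⟩, fun h2 => ?_,
    fun i hi hik => ?_⟩
  · obtain ⟨p, rfl⟩ : ∃ p, k = p + 1 := ⟨k - 1, by omega⟩
    exact JetVar.isProjectiveBundle_PJet (by omega)
  · obtain ⟨p, rfl⟩ : ∃ p, i = p + 1 := ⟨i - 1, by omega⟩
    have hp : 1 ≤ p := by omega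
    have himg := JetVar.forget_image_PJet hp hik
    rw [himg]
    exact ⟨JetVar.isClosed_jetImage hp hik, JetVar.isBlowup_PJet hp hik _⟩
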